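/- Let $(V,\circ,e)$ be a finite-dimensional Euclidean Jordan algebra over $\mathbb R$ with identity $e$, that is, $\circ$ is bilinear and commutative, $x\circ(x^2\circ y)=x^2\circ(x\circ y)$, $x\circ e=x$, and $V$ carries an associative positive definite bilinear form. Let $r$ be its rank (the smallest integer such that $e,x,\dots,x^r$ are linearly dependent for every $x\in V$). For $x\in V$ let $\lambda(x)\in\mathbb R^r$ be the vector of eigenvalues in a spectral decomposition $x=\sum_{i=1}^r\lambda_i(x)c_i$ over a Jordan frame $c_1,\dots,c_r$; put $\operatorname{trace}(x)=\sum_i\lambda_i(x)$, $\langle x,y\rangle=\operatorname{trace}(x\circ y)$, $\|x\|_F=\sqrt{\langle x,x\rangle}$ and $\|x\|=\|\lambda(x)\|_\infty$. Let $\Omega$ be the interior of the cone of squares $\{x^2:x\in V\}$, let $\bar\Omega$ be its closure, let $\Delta(\Omega)=\{x\in\bar\Omega:\langle e,x\rangle=1\}$, and let $P:V\to V$ be the orthogonal projection, with respect to $\langle\cdot,\cdot\rangle$, onto a linear subspace of $V$. Fix $\bar u\in\Delta(\Omega)$ and for $\mu>0$, $v\in V$ let $$u_\mu(v)=\operatorname*{argmin}_{u\in\Delta(\Omega)}\Big\{\langle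 u,v\rangle+\frac{\mu}{2}\|u-\bar u\|_F^2\Big\}.$$ The smooth perceptron scheme starts from $u_0=\bar u$, $\mu_0=2$, $z_0=u_{\mu_0}(Pu_0)$ and, for $t=0,1,2,\dots$, with $\theta_t=\frac{2}{t+3}$, puts $$u_{t+1}=(1-\theta_t)(u_t+\theta_tz_t)+\theta_t^2\,u_{\mu_t}(Pu_t),\qquad \mu_{t+1}=(1-\theta_t)\mu_t,\qquad z_{t+1}=(1-\theta_t)z_t+\theta_t\,u_{\mu_{t+1}}(Pu_{t+1}).$$ Then one of the stopping conditions $Pu_t\in\Omega$ or $\|Pz_t\|_F\le\frac{1}{4r}\|z_t\|$ is reached after at most $8\sqrt2\,r^2-1$ iterations, that is, it holds for some integer $t$ with $0\le t\le 8\sqrt2\,r^2-1$. In the special case $V=\mathbb R^n$ with the componentwise product (so that $\bar\Omega=\mathbb R^n_+$ and $r=n$), one of the stopping conditions $Pu_t>0$ (componentwise) or $\|(Pz_t)^+\|_2\le\frac{1}{3\sqrt n}\|z_t\|_\infty$, where $v^+=\max(v,0)$ componentwise, is reached after at most $6n\sqrt{2n}-1$ iterations, that is, it holds for some integer $t$ with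 $0\le t\le 6n\sqrt{2n}-1$. -/

import Mathlib

/-- A Euclidean Jordan algebra: a commutative unital real algebra `V` (product `*`, identity `1`)
that satisfies the Jordan identity and carries an associative positive definite bilinear form. -/
class IsEuclideanJordanAlgebra (V : Type*) [NonAssocCommRing V] [Module ℝ V]
    [IsScalarTower ℝ V V] [SMulCommClass ℝ V V] : Prop where
  jordan : IsCommJordan V
  exists_form : ∃ B : V →ₗ[ℝ] V →ₗ[ℝ] ℝ,
    (∀ x y z : V, B (x * y) z = B x (y * z)) ∧ ∀ x : V, x ≠ 0 → 0 < B x x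

noncomputable section

namespace SmoothPerceptron

section Algebra

variable {V : Type*} [NonAssocCommRing V]

/-- The powers `x⁰ = e`, `xᵏ⁺¹ = x ∘ xᵏ`. -/
def jpow (x : V) : ℕ → V
  | 0 => 1
  | k + 1 => x * jpow x k

/-- The rank: the least `r` such that `e, x, …, xʳ` are linearly dependent for every `x`. -/
def jordanRank (V : Type*) [NonAssocCommRing V] [Module ℝ V] : ℕ :=
  sInf {r : ℕ | ∀ x : V, ¬ LinearIndependent ℝ (fun i : Fin (r + 1) => jpow x (i : ℕ))}

/-- A primitive idempotent: an idempotent that is not the sum of two other idempotents. -/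
def IsPrimitiveIdempotent (c : V) : Prop :=
  c * c = c ∧ ¬ ∃ a b : V, a * a = a ∧ b * b = b ∧ a ≠ c ∧ b ≠ c ∧ c = a + b

/-- A Jordan frame `c₁, …, c_k`: non-zero, pairwise orthogonal primitive idempotents with
sum `e`. -/
def IsJordanFrame {k : ℕ} (c : Fin k → V) : Prop :=
  (∀ i, c i ≠ 0 ∧ IsPrimitiveIdempotent (c i)) ∧ (∀ i j, i ≠ j → c i * c j = 0) ∧ ∑ i, c i = 1

variable [Module ℝ V]

/-- `x = ∑ᵢ lamᵢ cᵢ` is a spectral decomposition of `x`, with a Jordan frame of `rank V`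
elements. -/
def IsSpectralDecomposition (x : V) (lam : Fin (jordanRank V) → ℝ)
    (c : Fin (jordanRank V) → V) : Prop :=
  IsJordanFrame c ∧ x = ∑ i, lam i • c i

open Classical in
/-- The vector of eigenvalues of `x`, read off from a spectral decomposition of `x`. -/
def eigenvalues (x : V) : Fin (jordanRank V) → ℝ :=
  if h : ∃ lam : Fin (jordanRank V) → ℝ, ∃ c, IsSpectralDecomposition x lam c then h.choose else 0

/-- The trace: the sum of the eigenvalues. -/
def trace (x : V) : ℝ := ∑ i, eigenvalues x i

/-- The operator norm: the largest absolute value of an eigenvalue (the norm on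
`Fin r → ℝ` is the sup norm). -/
def opNorm (x : V) : ℝ := ‖eigenvalues x‖

/-- The trace inner product `⟨x, y⟩ = trace (x ∘ y)`. -/
def ip (x y : V) : ℝ := trace (x * y)

/-- The Frobenius norm `√⟨x, x⟩`. -/
def frobNorm (x : V) : ℝ := √(ip x x)

/-- `P` is the projection onto the subspace `L` that is orthogonal for the trace inner product. -/
def IsOrthProj (L : Submodule ℝ V) (P : V →ₗ[ℝ] V) : Prop :=
  (∀ x, P x ∈ L) ∧ ∀ x, ∀ y ∈ L, ip (x - P x) y = 0

variable [TopologicalSpace V]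

/-- `Ω`, the interior of the cone of squares. -/
def openCone (V : Type*) [NonAssocCommRing V] [TopologicalSpace V] : Set V :=
  interior (Set.range fun x : V => x * x)

/-- The spectraplex `Δ(Ω)`: the points `x` of the closure of `Ω` with `⟨e, x⟩ = 1`. -/
def spectraplex (V : Type*) [NonAssocCommRing V] [Module ℝ V] [TopologicalSpace V] : Set V :=
  {x | x ∈ closure (openCone V) ∧ ip 1 x = 1}

/-- `u_μ(v)`: the minimizer over `u ∈ Δ(Ω)` of `⟨u, v⟩ + (μ / 2) ‖u - ū‖_F²`. -/
def smoothMin (ubar : V) (μ : ℝ) (v : V) : V :=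
  Classical.epsilon fun u => u ∈ spectraplex V ∧
    IsMinOn (fun w => ip w v + μ / 2 * frobNorm (w - ubar) ^ 2) (spectraplex V) u

/-- The data `(u_t, μ_t, z_t)` of the smooth perceptron scheme after `t` iterations. -/
structure State (V : Type*) where
  u : V
  mu : ℝ
  z : V

/-- The initialization `u₀ = ū`, `μ₀ = 2`, `z₀ = u_{μ₀}(P u₀)`. -/
def initState (P : V →ₗ[ℝ] V) (ubar : V) : State V where
  u := ubar
  mu := 2
  z := smoothMin ubar 2 (P ubar)

/-- The update of `(u_t, μ_t, z_t)` in iteration `t`, with `θ_t = 2 / (t + 3)`. -/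
def nextState (P : V →ₗ[ℝ] V) (ubar : V) (t : ℕ) (s : State V) : State V :=
  let θ : ℝ := 2 / ((t : ℝ) + 3)
  let u' : V := (1 - θ) • (s.u + θ • s.z) + θ ^ 2 • smoothMin ubar s.mu (P s.u)
  let mu' : ℝ := (1 - θ) * s.mu
  { u := u'
    mu := mu'
    z := (1 - θ) • s.z + θ • smoothMin ubar mu' (P u') }

/-- The iterates of the smooth perceptron scheme with projection `P` and center `ū`. -/
def iterate (P : V →ₗ[ℝ] V) (ubar : V) : ℕ → State V
  | 0 => initState P ubar
  | t + 1 => nextState P ubar t (iterate P ubar t)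

end Algebra

end SmoothPerceptron

end

/-!
The proof has two independent halves.

*Euclidean Jordan algebras.* The conditions are phrased through eigenvalues, so one needs that the
trace is linear and that `⟨x, y⟩ = trace (x ∘ y)` is an associative positive definite form.
Power associativity, together with the symmetry of multiplication operators for the given form `B`,
provides the spectral theorem (`IsAssocForm.exists_jordanFrame`). For a primitive idempotent `c` the
operator `2 L_c² - L_c` is the `B`-orthogonal projection onto the line of `c`. This forces two
primitive idempotents that are not orthogonal to have the same `B`-norm
(`IsAssocForm.primitive_norm_eq`), so that for a Jordan frame `c₁, …, c_k` the element
`h = ∑ cᵢ / B(cᵢ, cᵢ)` satisfies `B(h, d) = 1` for *every* primitive idempotent `d ≠ 0`. Hence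
`trace = B(h, ·)`; all frames have the same size, which is the rank; and `h` is central, so that
`B(h ∘ x, y)` is the trace form and is associative (`exists_normalized_form`). The cone of squares
is then self-dual, the spectraplex is compact and convex with diameter at most `√2`, and a point
outside the open cone is separated from it by a primitive idempotent.

*The scheme.* The excessive gap
`-½ ‖P u_t‖² + min_s {⟨P u_t, s⟩ + (μ_t / 2) ‖s - ū‖²} - ½ ‖P z_t‖²` remains non-negative
(`excessGap_step`), where `μ_t = 4 / ((t + 1) (t + 2))`. If `P u_t ∉ Ω`, the minimum is at most
`μ_t`, whence `‖P z_t‖² ≤ 8 / ((t + 1) (t + 2))`, while `‖z_t‖ ≥ 1 / r`. Because `t` has to be an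
integer that is at most `A - 1`, with `A = 8 √2 r²` (or `A = 6 n √(2 n)`), this estimate alone is
short of the claim by a relative error of order `1 / A` when `A` is large and its fractional part is
close to one. The deficit is covered by the variance term `‖P (u - z)‖²` that one step adds to the
excessive gap: if the scheme did not stop at `t - 1`, then `‖P z_{t-1}‖²` is close to its upper
bound, so `P u_{t-1}` is small and the variance term is large (`last_step_contradiction`,
`IsTraceForm.exists_iterate_le`).
-/

noncomputable section

namespace SmoothPerceptron

open Polynomial Filter Topology

/-! ### Power associativity -/

section Jordan

variable {V : Type*} [NonAssocCommRing V] [Module ℝ V]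

/-- The linearized Jordan identity. -/
lemma jordan_linearized [IsCommJordan V] (a b c d : V) :
    a * ((b * c) * d) + b * ((c * a) * d) + c * ((a * b) * d) =
      (b * c) * (a * d) + (c * a) * (b * d) + (a * b) * (c * d) := by
  have h := DFunLike.congr_fun (two_nsmul_lie_lmul_lmul_add_add_eq_zero a b c) d
  have h2 : (2 : ℝ) • (a * ((b * c) * d) - (b * c) * (a * d) + (b * ((c * a) * d) -
      (c * a) * (b * d)) + (c * ((a * b) * d) - (a * b) * (c * d))) = 0 := by
    rw [two_smul, ← two_nsmul]
    exact h
  have h3 := (smul_eq_zero.mp h2).resolve_left two_ne_zero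
  rw [← sub_eq_zero, ← h3]
  abel

/-- The right-hand side of the linearized Jordan identity is symmetric in its four arguments, so
the left-hand side is symmetric under the exchange of `a` and `d`. -/
lemma mul_mul_mul_exchange [IsCommJordan V] (a b c d : V) :
    (a * (b * c)) * d = a * ((b * c) * d) + b * ((c * a) * d) + c * ((a * b) * d)
      - b * (a * (c * d)) - c * (a * (b * d)) := by
  have h1 := jordan_linearized a b c d
  have h2 := jordan_linearized d b c a
  have e1 : d * ((b * c) * a) = (a * (b * c)) * d := by
    rw [mul_comm d, mul_comm (b * c) a]
  have e2 : b * ((c * d) * a) = b * (a * (c * d)) := by rw [mul_comm (c * d) a]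
  have e3 : c * ((d * b) * a) = c * (a * (b * d)) := by rw [mul_comm d b, mul_comm (b * d) a]
  have e4 : (b * c) * (d * a) = (b * c) * (a * d) := by rw [mul_comm d a]
  have e5 : (c * d) * (b * a) = (a * b) * (c * d) := by rw [mul_comm b a, mul_comm (c * d)]
  have e6 : (d * b) * (c * a) = (c * a) * (b * d) := by rw [mul_comm d b, mul_comm (b * d)]
  rw [e1, e2, e3, e4, e5, e6] at h2
  rw [h1]
  have h3 : (a * (b * c)) * d = (b * c) * (a * d) + (a * b) * (c * d) + (c * a) * (b * d)
      - b * (a * (c * d)) - c * (a * (b * d)) := by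
    rw [← h2]; abel
  rw [h3]; abel

/-- Multiplication by a power of `x` commutes with multiplication by `x`. -/
lemma jpow_mul_comm_mul [IsCommJordan V] (x : V) (n : ℕ) (y : V) :
    jpow x n * (x * y) = x * (jpow x n * y) := by
  induction n using Nat.strong_induction_on generalizing y with
  | _ n ih =>
    match n, ih with
    | 0, _ => simp [jpow]
    | 1, _ => simp [jpow]
    | n + 2, ih =>
      have hrec : ∀ y, jpow x (n + 2) * y = x * (jpow x (n + 1) * y) + x * (jpow x (n + 1) * y)
          + jpow x n * ((x * x) * y) - x * (x * (jpow x n * y)) - jpow x n * (x * (x * y)) := by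
        intro y
        have h := mul_mul_mul_exchange x x (jpow x n) y
        rw [mul_comm (jpow x n) x] at h
        exact h
      have hJ : (x * x) * (x * y) = x * ((x * x) * y) := IsJordan.lmul_lmul_comm_lmul x y
      have i0 := ih n (by omega)
      have i1 := ih (n + 1) (by omega)
      rw [hrec, hrec, i1, hJ, i0, i0, i0, i0]
      simp only [mul_add, mul_sub]

/-- An idempotent `c` satisfies `2L³ - 3L² + L = 0`, where `L` is multiplication by `c`. -/
lemma idempotent_cubic [IsCommJordan V] {c : V} (hc : c * c = c) (x : V) :
    c * x = c * (c * x) + c * (c * x) + c * (c * x) - c * (c * (c * x)) - c * (c * (c * x)) := by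
  have h := mul_mul_mul_exchange c c c x
  simp only [hc] at h
  exact h

/-- Multiplications by two orthogonal idempotents commute. -/
lemma mul_comm_mul_of_orthogonal [IsCommJordan V] {c d : V} (hc : c * c = c)
    (hcd : c * d = 0) (x : V) : c * (d * x) = d * (c * x) := by
  have h := jordan_linearized c c d x
  have hdc : d * c = 0 := by rw [mul_comm, hcd]
  simp only [hc, hcd, hdc, zero_mul, mul_zero, zero_add] at h
  exact h.symm

variable [SMulCommClass ℝ V V]

/-- The value of a polynomial at `x`, through powers of the operator of multiplication by `x`. -/
def polyEval (x : V) : ℝ[X] →ₗ[ℝ] V :=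
  (LinearMap.applyₗ (1 : V)).comp (aeval (LinearMap.mulLeft ℝ x)).toLinearMap

lemma polyEval_apply (x : V) (p : ℝ[X]) :
    polyEval x p = aeval (LinearMap.mulLeft ℝ x) p 1 := rfl

lemma polyEval_one (x : V) : polyEval x 1 = 1 := by simp [polyEval_apply]

lemma polyEval_X_mul (x : V) (p : ℝ[X]) : polyEval x (X * p) = x * polyEval x p := by
  simp [polyEval_apply]

lemma polyEval_X (x : V) : polyEval x X = x := by simp [polyEval_apply]

lemma polyEval_X_pow (x : V) (n : ℕ) : polyEval x (X ^ n) = jpow x n := by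
  induction n with
  | zero => simp [polyEval_one, jpow]
  | succ n ih => rw [pow_succ', polyEval_X_mul, ih, jpow]

variable [IsScalarTower ℝ V V]

lemma polyEval_mul_comm_mul [IsCommJordan V] (x : V) (p : ℝ[X]) (y : V) :
    polyEval x p * (x * y) = x * (polyEval x p * y) := by
  induction p using Polynomial.induction_on' with
  | add p q hp hq => simp only [map_add, add_mul, mul_add, hp, hq]
  | monomial n a =>
    rw [← C_mul_X_pow_eq_monomial, ← smul_eq_C_mul, map_smul, polyEval_X_pow, smul_mul_assoc,
      jpow_mul_comm_mul, smul_mul_assoc, mul_smul_comm]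

/-- Power associativity: evaluation at `x` is multiplicative. -/
lemma polyEval_mul [IsCommJordan V] (x : V) (p q : ℝ[X]) :
    polyEval x (p * q) = polyEval x p * polyEval x q := by
  induction q using Polynomial.induction_on' with
  | add q r hq hr => simp only [map_add, mul_add, hq, hr]
  | monomial n a =>
    rw [← C_mul_X_pow_eq_monomial, ← smul_eq_C_mul, mul_smul_comm, map_smul, map_smul,
      mul_smul_comm]
    congr 1
    induction n with
    | zero => simp [polyEval_one]
    | succ n ih =>
      rw [pow_succ', mul_left_comm, polyEval_X_mul, ih, polyEval_X_mul, polyEval_mul_comm_mul]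

end Jordan

/-! ### Associative positive definite forms -/

section Form

variable {V : Type*} [NonAssocCommRing V] [Module ℝ V]

/-- An associative positive definite bilinear form on `V`. -/
structure IsAssocForm (B : V →ₗ[ℝ] V →ₗ[ℝ] ℝ) : Prop where
  assoc : ∀ x y z : V, B (x * y) z = B x (y * z)
  pos : ∀ x : V, x ≠ 0 → 0 < B x x

namespace IsAssocForm

variable {B : V →ₗ[ℝ] V →ₗ[ℝ] ℝ}

lemma eq_one_mul (hB : IsAssocForm B) (x y : V) : B x y = B 1 (x * y) := by
  rw [← hB.assoc, one_mul]

lemma symm (hB : IsAssocForm B) (x y : V) : B x y = B y x := by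
  rw [hB.eq_one_mul, mul_comm, ← hB.eq_one_mul]

lemma mul_left (hB : IsAssocForm B) (c x y : V) : B (c * x) y = B x (c * y) := by
  rw [mul_comm, hB.assoc]

lemma nonneg (hB : IsAssocForm B) (x : V) : 0 ≤ B x x := by
  rcases eq_or_ne x 0 with rfl | h
  · simp
  · exact (hB.pos x h).le

lemma eq_zero (hB : IsAssocForm B) {x : V} (h : B x x ≤ 0) : x = 0 := by
  by_contra hx
  exact absurd (hB.pos x hx) (not_lt.mpr h)

/-- Multiplication `L` by an idempotent is positive semidefinite, because its eigenvalues lie in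
`{0, 1/2, 1}`; concretely, `L = L² + 4 (L - L²)²`. -/
lemma idempotent_mul_apply_self [IsCommJordan V] (hB : IsAssocForm B) {c : V} (hc : c * c = c)
    (x : V) : B (c * x) x =
      B (c * x) (c * x) + 4 * B (c * x - c * (c * x)) (c * x - c * (c * x)) := by
  have h3 := idempotent_cubic hc x
  have h4 := idempotent_cubic hc (c * x)
  have e1 := congrArg (B x) h3
  have e2 := congrArg (B x) h4
  simp only [map_add, map_sub] at e1 e2
  simp only [map_sub, LinearMap.sub_apply, hB.mul_left]
  linarith

lemma le_idempotent_mul_apply_self [IsCommJordan V] (hB : IsAssocForm B) {c : V} (hc : c * c = c)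
    (x : V) : B (c * x) (c * x) ≤ B (c * x) x := by
  have := hB.nonneg (c * x - c * (c * x))
  rw [hB.idempotent_mul_apply_self hc x]
  linarith

lemma idempotent_mul_self_nonneg [IsCommJordan V] (hB : IsAssocForm B) {c : V} (hc : c * c = c)
    (x : V) : 0 ≤ B c (x * x) := by
  rw [← hB.assoc]
  exact (hB.nonneg _).trans (hB.le_idempotent_mul_apply_self hc x)

lemma idempotent_nonneg [IsCommJordan V] (hB : IsAssocForm B) {c d : V} (hc : c * c = c)
    (hd : d * d = d) : 0 ≤ B c d := by
  have := hB.idempotent_mul_self_nonneg hc d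
  rwa [hd] at this

lemma idempotent_mul_eq_zero [IsCommJordan V] (hB : IsAssocForm B) {c d : V} (hc : c * c = c)
    (hd : d * d = d) (h : B c d ≤ 0) : c * d = 0 := by
  refine hB.eq_zero ((hB.le_idempotent_mul_apply_self hc d).trans ?_)
  rwa [hB.assoc, hd]

end IsAssocForm

/-- A positive definite symmetric form is the pullback of the Euclidean inner product. -/
lemma exists_equiv_euclidean [FiniteDimensional ℝ V] {B : V →ₗ[ℝ] V →ₗ[ℝ] ℝ}
    (hB : IsAssocForm B) : ∃ (n : ℕ) (e : V ≃ₗ[ℝ] EuclideanSpace ℝ (Fin n)),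
      ∀ x y, B x y = inner ℝ (e x) (e y) := by
  let core : InnerProductSpace.Core ℝ V :=
    { inner := fun x y => B x y
      conj_inner_symm := fun x y => hB.symm y x
      re_inner_nonneg := fun x => hB.nonneg x
      add_left := fun x y z => by simp
      smul_left := fun x y r => by simp
      definite := fun x h => hB.eq_zero (le_of_eq h) }
  let _ : NormedAddCommGroup V := core.toNormedAddCommGroup
  let _ : InnerProductSpace ℝ V := InnerProductSpace.ofCore core.toCore
  refine ⟨_, (stdOrthonormalBasis ℝ V).repr.toLinearEquiv, fun x y => ?_⟩
  exact ((stdOrthonormalBasis ℝ V).repr.inner_map_map x y).symm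

end Form

/-! ### The spectral theorem -/

section Spectral

variable {V : Type*} [NonAssocCommRing V] [Module ℝ V] {B : V →ₗ[ℝ] V →ₗ[ℝ] ℝ}

/-- Multiplication by `x` is symmetric for an associative form, hence diagonalizable. -/
lemma IsAssocForm.exists_finset_aeval_mulLeft_eq_zero [SMulCommClass ℝ V V]
    [FiniteDimensional ℝ V] (hB : IsAssocForm B) (x : V) :
    ∃ S : Finset ℝ, aeval (LinearMap.mulLeft ℝ x) (∏ a ∈ S, (X - C a)) = 0 := by
  classical
  obtain ⟨n, e, he⟩ := exists_equiv_euclidean hB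
  set T : EuclideanSpace ℝ (Fin n) →ₗ[ℝ] EuclideanSpace ℝ (Fin n) :=
    e.toLinearMap ∘ₗ LinearMap.mulLeft ℝ x ∘ₗ e.symm.toLinearMap with hTdef
  have hT : T.IsSymmetric := by
    intro u v
    have h := hB.mul_left x (e.symm u) (e.symm v)
    rw [he, he] at h
    simpa [hTdef] using h
  have hn : Module.finrank ℝ (EuclideanSpace ℝ (Fin n)) = n := by simp
  refine ⟨Finset.univ.image (hT.eigenvalues hn), ?_⟩
  refine ((hT.eigenvectorBasis hn).toBasis.map e.symm).ext fun i => ?_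
  set v := e.symm (hT.eigenvectorBasis hn i) with hv
  have hev : LinearMap.mulLeft ℝ x v = hT.eigenvalues hn i • v := by
    have h := hT.apply_eigenvectorBasis hn i
    apply e.injective
    rw [map_smul, hv, e.apply_symm_apply]
    exact h
  have hmem : hT.eigenvalues hn i ∈ Finset.univ.image (hT.eigenvalues hn) :=
    Finset.mem_image_of_mem _ (Finset.mem_univ i)
  have hz : aeval (LinearMap.mulLeft ℝ x)
      (∏ a ∈ Finset.univ.image (hT.eigenvalues hn), (X - C a)) v = 0 := by
    rw [← Finset.prod_erase_mul _ _ hmem, map_mul, Module.End.mul_apply, map_sub, aeval_X, aeval_C,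
      LinearMap.sub_apply, hev]
    simp
  simpa using hz

/-- A version of the spectral theorem: `x` is a linear combination of orthogonal idempotents with
sum `1`, namely the values at `x` of the Lagrange polynomials on the spectrum of `x`. -/
lemma IsAssocForm.exists_orthogonal_idempotents [IsCommJordan V] [SMulCommClass ℝ V V]
    [IsScalarTower ℝ V V] [FiniteDimensional ℝ V] (hB : IsAssocForm B) (x : V) :
    ∃ (S : Finset ℝ) (e : ℝ → V), (∀ a ∈ S, e a * e a = e a) ∧
      (∀ a ∈ S, ∀ b ∈ S, a ≠ b → e a * e b = 0) ∧ ∑ a ∈ S, e a = 1 ∧ x = ∑ a ∈ S, a • e a := by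
  classical
  obtain ⟨S, hS⟩ := hB.exists_finset_aeval_mulLeft_eq_zero x
  have key : ∀ p q : ℝ[X], (∀ a ∈ S, p.eval a = q.eval a) → polyEval x p = polyEval x q := by
    intro p q h
    have hdvd : ∏ a ∈ S, (X - C a) ∣ p - q := by
      refine Finset.prod_dvd_of_coprime ?_ fun a ha => ?_
      · intro a _ b _ hab
        exact isCoprime_X_sub_C_of_isUnit_sub (sub_ne_zero.mpr hab).isUnit
      · rw [dvd_iff_isRoot, IsRoot.def, eval_sub, h a ha, sub_self]
    obtain ⟨r, hr⟩ := hdvd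
    rw [← sub_eq_zero, ← map_sub, hr, polyEval_apply, map_mul, hS, zero_mul,
      LinearMap.zero_apply]
  have hself : ∀ a ∈ S, (Lagrange.basis S id a).eval a = 1 := fun a ha =>
    Lagrange.eval_basis_self (v := id) (Set.injOn_id _) ha
  have hne : ∀ a, ∀ b ∈ S, a ≠ b → (Lagrange.basis S id a).eval b = 0 := fun a b hb hab =>
    Lagrange.eval_basis_of_ne (v := id) hab hb
  refine ⟨S, fun a => polyEval x (Lagrange.basis S id a), ?_, ?_, ?_, ?_⟩
  · intro a ha
    rw [← polyEval_mul]
    refine key _ _ fun b hb => ?_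
    rcases eq_or_ne a b with rfl | hab
    · simp [hself a ha]
    · simp [hne a b hb hab]
  · intro a ha b hb hab
    rw [← polyEval_mul, ← map_zero (polyEval x)]
    refine key _ _ fun d hd => ?_
    rcases eq_or_ne a d with rfl | had
    · simp [hne b a ha hab.symm]
    · simp [hne a d hd had]
  · rw [← map_sum, ← polyEval_one x]
    refine key _ _ fun b hb => ?_
    rw [eval_finsetSum, Finset.sum_eq_single b (fun a _ hab => hne a b hb hab)
      (fun h => absurd hb h), hself b hb, eval_one]
  · conv_lhs => rw [← polyEval_X x]
    simp only [← map_smul]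
    rw [← map_sum]
    refine key _ _ fun b hb => ?_
    rw [eval_finsetSum, Finset.sum_eq_single b (fun a _ hab => by simp [hne a b hb hab])
      (fun h => absurd hb h), eval_smul, hself b hb, eval_X, smul_eq_mul, mul_one]

/-- The Peirce space `V₁(c)` of a primitive idempotent `c` is one-dimensional. -/
lemma IsAssocForm.eq_smul_of_primitive_mul_eq [IsCommJordan V] [SMulCommClass ℝ V V]
    [IsScalarTower ℝ V V] [FiniteDimensional ℝ V] (hB : IsAssocForm B) {c y : V}
    (hc : IsPrimitiveIdempotent c) (hy : c * y = y) : ∃ α : ℝ, y = α • c := by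
  obtain ⟨hcc, hprim⟩ := hc
  obtain ⟨S, e, he, horth, -, hsum⟩ := hB.exists_orthogonal_idempotents y
  have hf : (1 - c) * (1 - c) = 1 - c := by
    simp [sub_mul, mul_sub, hcc]
  have hfy : (1 - c) * y = 0 := by rw [sub_mul, one_mul, hy, sub_self]
  -- `y²` is the combination of the idempotents `e a` with weights `a²`
  have hyy : y * y = ∑ a ∈ S, (a * a) • e a := by
    conv_lhs => rw [hsum]
    rw [Finset.sum_mul]
    refine Finset.sum_congr rfl fun a ha => ?_
    rw [Finset.mul_sum, Finset.sum_eq_single a]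
    · rw [smul_mul_smul_comm, he a ha]
    · intro b hb hba
      rw [smul_mul_smul_comm, horth a ha b hb hba.symm, smul_zero]
    · exact fun h => absurd ha h
  have hzero : ∑ a ∈ S, (a * a) * B (1 - c) (e a) = 0 := by
    have h : B (1 - c) (y * y) = 0 := by rw [← hB.assoc, hfy, map_zero, LinearMap.zero_apply]
    rw [hyy, map_sum] at h
    simpa using h
  have hterm := (Finset.sum_eq_zero_iff_of_nonneg fun a ha =>
    mul_nonneg (mul_self_nonneg a) (hB.idempotent_nonneg hf (he a ha))).mp hzero
  have hcase : ∀ a ∈ S, ∃ β : ℝ, a • e a = β • c := by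
    intro a ha
    rcases eq_or_ne a 0 with rfl | ha0
    · exact ⟨0, by simp⟩
    have h0 : B (1 - c) (e a) = 0 :=
      (mul_eq_zero.mp (hterm a ha)).resolve_left (mul_ne_zero ha0 ha0)
    have h1 := hB.idempotent_mul_eq_zero hf (he a ha) h0.le
    rw [sub_mul, one_mul, sub_eq_zero] at h1
    by_cases h2 : e a = c
    · exact ⟨a, by rw [h2]⟩
    by_cases h3 : c - e a = c
    · exact ⟨0, by rw [sub_eq_self.mp h3]; simp⟩
    refine absurd ⟨e a, c - e a, he a ha, ?_, h2, h3, by abel⟩ hprim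
    rw [sub_mul, mul_sub, mul_sub, hcc, he a ha, mul_comm (e a) c, ← h1]
    abel
  choose! β hβ using hcase
  refine ⟨∑ a ∈ S, β a, ?_⟩
  rw [Finset.sum_smul]
  conv_lhs => rw [hsum]
  exact Finset.sum_congr rfl hβ

/-- A finite set of non-zero, pairwise orthogonal idempotents with sum `1`. -/
structure IsOrthSystem (s : Finset V) : Prop where
  ne_zero : ∀ c ∈ s, c ≠ 0
  idem : ∀ c ∈ s, c * c = c
  orth : ∀ c ∈ s, ∀ d ∈ s, c ≠ d → c * d = 0
  sum_eq : ∑ c ∈ s, c = 1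

lemma IsOrthSystem.card_le_finrank [SMulCommClass ℝ V V] [FiniteDimensional ℝ V]
    {s : Finset V} (hs : IsOrthSystem s) : s.card ≤ Module.finrank ℝ V := by
  have hli : LinearIndependent ℝ (fun c : s => (c : V)) := by
    rw [Fintype.linearIndependent_iff]
    intro g hg c
    have h := congrArg (fun y => (c : V) * y) hg
    simp only [Finset.mul_sum, mul_zero] at h
    rw [Finset.sum_eq_single c] at h
    · rw [mul_smul_comm, hs.idem c c.2] at h
      exact (smul_eq_zero.mp h).resolve_right (hs.ne_zero c c.2)
    · intro d _ hdc
      rw [mul_smul_comm, hs.orth c c.2 d d.2 (fun h => hdc (Subtype.ext h.symm)), smul_zero]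
    · exact fun h => absurd (Finset.mem_univ c) h
  simpa using hli.fintype_card_le_finrank

/-- An orthogonal system that contains a non-primitive idempotent can be refined. -/
lemma IsOrthSystem.exists_refinement [IsCommJordan V] [SMulCommClass ℝ V V] [IsScalarTower ℝ V V]
    (hB : IsAssocForm B) {s : Finset V} (hs : IsOrthSystem s) {c : V} (hcs : c ∈ s)
    (hc : ¬ IsPrimitiveIdempotent c) :
    ∃ s' : Finset V, IsOrthSystem s' ∧ s'.card = s.card + 1 ∧
      Submodule.span ℝ (s : Set V) ≤ Submodule.span ℝ (s' : Set V) := by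
  classical
  have hex : ∃ a b : V, a * a = a ∧ b * b = b ∧ a ≠ c ∧ b ≠ c ∧ c = a + b := by
    by_contra h
    exact hc ⟨hs.idem c hcs, h⟩
  obtain ⟨a, b, ha, hb, hac, hbc, hab⟩ := hex
  have ha0 : a ≠ 0 := by rintro rfl; exact hbc (by rw [hab, zero_add])
  have hb0 : b ≠ 0 := by rintro rfl; exact hac (by rw [hab, add_zero])
  have hmul : a * b = 0 := by
    have h := hs.idem c hcs
    rw [hab, add_mul, mul_add, mul_add, ha, hb, mul_comm b a] at h
    have h2 : (2 : ℝ) • (a * b) = 0 := by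
      rw [two_smul, ← sub_eq_zero.mpr h]; abel
    exact (smul_eq_zero.mp h2).resolve_left two_ne_zero
  have hd : ∀ d ∈ s.erase c, a * d = 0 ∧ b * d = 0 := by
    intro d hd
    obtain ⟨hdc, hds⟩ := Finset.mem_erase.mp hd
    have hdd := hs.idem d hds
    have h : B a d + B b d = 0 := by
      rw [← LinearMap.add_apply, ← map_add, ← hab, hB.eq_one_mul, hs.orth c hcs d hds hdc.symm,
        map_zero]
    have h1 := hB.idempotent_nonneg ha hdd
    have h2 := hB.idempotent_nonneg hb hdd
    exact ⟨hB.idempotent_mul_eq_zero ha hdd (by linarith),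
      hB.idempotent_mul_eq_zero hb hdd (by linarith)⟩
  have hne : a ≠ b := by rintro rfl; exact ha0 (by rw [← ha, hmul])
  have has : a ∉ s.erase c := fun h => ha0 (by rw [← ha, (hd a h).1])
  have hbs : b ∉ s.erase c := fun h => hb0 (by rw [← hb, (hd b h).2])
  have hains : a ∉ insert b (s.erase c) := by
    rw [Finset.mem_insert, not_or]
    exact ⟨hne, has⟩
  refine ⟨insert a (insert b (s.erase c)), ⟨?_, ?_, ?_, ?_⟩, ?_, ?_⟩
  · intro d hd'
    rcases Finset.mem_insert.mp hd' with rfl | hd'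
    · exact ha0
    rcases Finset.mem_insert.mp hd' with rfl | hd'
    · exact hb0
    exact hs.ne_zero d (Finset.mem_of_mem_erase hd')
  · intro d hd'
    rcases Finset.mem_insert.mp hd' with rfl | hd'
    · exact ha
    rcases Finset.mem_insert.mp hd' with rfl | hd'
    · exact hb
    exact hs.idem d (Finset.mem_of_mem_erase hd')
  · intro d hd' f hf' hdf
    rw [Finset.mem_insert, Finset.mem_insert] at hd' hf'
    rcases hd' with rfl | rfl | hd' <;> rcases hf' with rfl | rfl | hf'
    · exact absurd rfl hdf
    · exact hmul
    · exact (hd f hf').1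
    · rw [mul_comm]; exact hmul
    · exact absurd rfl hdf
    · exact (hd f hf').2
    · rw [mul_comm]; exact (hd d hd').1
    · rw [mul_comm]; exact (hd d hd').2
    · exact hs.orth d (Finset.mem_of_mem_erase hd') f (Finset.mem_of_mem_erase hf') hdf
  · rw [Finset.sum_insert hains, Finset.sum_insert hbs, ← add_assoc, ← hab,
      Finset.add_sum_erase _ (fun d => d) hcs, hs.sum_eq]
  · rw [Finset.card_insert_of_notMem hains, Finset.card_insert_of_notMem hbs,
      Finset.card_erase_add_one hcs]
  · rw [Submodule.span_le]
    intro d hds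
    by_cases hdc : d = c
    · rw [hdc, hab]
      exact Submodule.add_mem _ (Submodule.subset_span (by simp)) (Submodule.subset_span (by simp))
    · exact Submodule.subset_span (by simp [hdc, Finset.mem_coe.mp hds])

/-- The spectral theorem: each element is a linear combination of a Jordan frame. -/
lemma IsAssocForm.exists_jordanFrame [IsCommJordan V] [SMulCommClass ℝ V V] [IsScalarTower ℝ V V]
    [FiniteDimensional ℝ V] (hB : IsAssocForm B) (x : V) :
    ∃ (k : ℕ) (c : Fin k → V) (lam : Fin k → ℝ), IsJordanFrame c ∧ x = ∑ i, lam i • c i := by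
  classical
  have hmain : ∃ s : Finset V, IsOrthSystem s ∧ x ∈ Submodule.span ℝ (s : Set V) ∧
      ∀ c ∈ s, IsPrimitiveIdempotent c := by
    by_contra hcon
    push Not at hcon
    -- without a system of primitive idempotents there are arbitrarily large orthogonal systems
    have hlarge : ∀ m : ℕ, ∃ s : Finset V, IsOrthSystem s ∧ x ∈ Submodule.span ℝ (s : Set V) ∧
        m ≤ s.card := by
      intro m
      induction m with
      | zero =>
        obtain ⟨S, e, he, horth, hone, hsum⟩ := hB.exists_orthogonal_idempotents x
        have hinj : Set.InjOn e (S.filter fun a => e a ≠ 0 : Finset ℝ) := by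
          intro a ha b hb hab
          simp only [Finset.coe_filter, Set.mem_ofPred_eq] at ha hb
          by_contra hne
          apply ha.2
          have h := horth a ha.1 b hb.1 hne
          rwa [← hab, he a ha.1] at h
        refine ⟨(S.filter fun a => e a ≠ 0).image e, ⟨?_, ?_, ?_, ?_⟩, ?_, Nat.zero_le _⟩
        · intro c hc
          obtain ⟨a, ha, rfl⟩ := Finset.mem_image.mp hc
          exact (Finset.mem_filter.mp ha).2
        · intro c hc
          obtain ⟨a, ha, rfl⟩ := Finset.mem_image.mp hc
          exact he a (Finset.mem_filter.mp ha).1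
        · intro c hc d hd hcd
          obtain ⟨a, ha, rfl⟩ := Finset.mem_image.mp hc
          obtain ⟨b, hb, rfl⟩ := Finset.mem_image.mp hd
          exact horth a (Finset.mem_filter.mp ha).1 b (Finset.mem_filter.mp hb).1
            (fun h => hcd (by rw [h]))
        · rw [Finset.sum_image hinj, Finset.sum_filter_ne_zero, hone]
        · rw [hsum]
          refine Submodule.sum_mem _ fun a ha => Submodule.smul_mem _ _ ?_
          by_cases h0 : e a = 0
          · rw [h0]; exact Submodule.zero_mem _
          · exact Submodule.subset_span (Finset.mem_coe.mpr (Finset.mem_image_of_mem e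
              (Finset.mem_filter.mpr ⟨ha, h0⟩)))
      | succ m ih =>
        obtain ⟨s, hs, hx, hm⟩ := ih
        obtain ⟨c, hcs, hc⟩ := hcon s hs hx
        obtain ⟨s', hs', hcard, hspan⟩ := hs.exists_refinement hB hcs hc
        exact ⟨s', hs', hspan hx, by omega⟩
    obtain ⟨s, hs, -, hcard⟩ := hlarge (Module.finrank ℝ V + 1)
    have := hs.card_le_finrank
    omega
  obtain ⟨s, hs, hx, hprim⟩ := hmain
  obtain ⟨g, -, hg⟩ := Submodule.mem_span_finset.mp hx
  let f : Fin s.card → V := fun i => (s.equivFin.symm i : V)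
  refine ⟨s.card, f, fun i => g (f i), ⟨?_, ?_, ?_⟩, ?_⟩
  · exact fun i => ⟨hs.ne_zero _ (s.equivFin.symm i).2, hprim _ (s.equivFin.symm i).2⟩
  · intro i j hij
    refine hs.orth _ (s.equivFin.symm i).2 _ (s.equivFin.symm j).2 fun h => hij ?_
    exact s.equivFin.symm.injective (Subtype.ext h)
  · rw [← hs.sum_eq, ← Finset.sum_coe_sort s]
    exact s.equivFin.symm.sum_comp (fun c : s => (c : V))
  · rw [← hg, ← Finset.sum_coe_sort s]
    exact (s.equivFin.symm.sum_comp (fun c : s => g (c : V) • (c : V))).symm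

end Spectral

/-! ### Jordan frames -/

section Frame

variable {V : Type*} [NonAssocCommRing V]

lemma IsJordanFrame.idem {k : ℕ} {c : Fin k → V} (hc : IsJordanFrame c) (i : Fin k) :
    c i * c i = c i := (hc.1 i).2.1

lemma IsJordanFrame.ne_zero {k : ℕ} {c : Fin k → V} (hc : IsJordanFrame c) (i : Fin k) :
    c i ≠ 0 := (hc.1 i).1

lemma IsJordanFrame.primitive {k : ℕ} {c : Fin k → V} (hc : IsJordanFrame c) (i : Fin k) :
    IsPrimitiveIdempotent (c i) := (hc.1 i).2

variable [Module ℝ V]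

lemma IsJordanFrame.sum_smul_mul [SMulCommClass ℝ V V] {k : ℕ} {c : Fin k → V}
    (hc : IsJordanFrame c) (a : Fin k → ℝ) (i : Fin k) : c i * (∑ j, a j • c j) = a i • c i := by
  rw [Finset.mul_sum, Finset.sum_eq_single i]
  · rw [mul_smul_comm, hc.idem]
  · intro j _ hji
    rw [mul_smul_comm, hc.2.1 i j hji.symm, smul_zero]
  · exact fun h => absurd (Finset.mem_univ i) h

lemma IsJordanFrame.sum_smul_mul_sum_smul [SMulCommClass ℝ V V] [IsScalarTower ℝ V V] {k : ℕ}
    {c : Fin k → V} (hc : IsJordanFrame c) (a b : Fin k → ℝ) :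
    (∑ i, a i • c i) * (∑ i, b i • c i) = ∑ i, (a i * b i) • c i := by
  rw [Finset.sum_mul]
  refine Finset.sum_congr rfl fun i _ => ?_
  rw [smul_mul_assoc, hc.sum_smul_mul, smul_smul]

lemma IsJordanFrame.eq_zero_of_sum_smul [SMulCommClass ℝ V V] {k : ℕ} {c : Fin k → V}
    (hc : IsJordanFrame c) {a : Fin k → ℝ} (h : ∑ i, a i • c i = 0) (i : Fin k) : a i = 0 := by
  have h1 := hc.sum_smul_mul a i
  rw [h, mul_zero] at h1
  exact (smul_eq_zero.mp h1.symm).resolve_right (hc.ne_zero i)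

lemma IsJordanFrame.jpow_sum_smul [SMulCommClass ℝ V V] [IsScalarTower ℝ V V] {k : ℕ}
    {c : Fin k → V} (hc : IsJordanFrame c) (a : Fin k → ℝ) (n : ℕ) :
    jpow (∑ i, a i • c i) n = ∑ i, (a i ^ n) • c i := by
  induction n with
  | zero => simp [jpow, hc.2.2]
  | succ n ih =>
    rw [jpow, ih, hc.sum_smul_mul_sum_smul]
    simp only [pow_succ']

end Frame

/-! ### The trace form -/

section Trace

variable {V : Type*} [NonAssocCommRing V] [Module ℝ V] [SMulCommClass ℝ V V] [IsScalarTower ℝ V V]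
  [FiniteDimensional ℝ V] [IsCommJordan V] {B : V →ₗ[ℝ] V →ₗ[ℝ] ℝ}

/-- The quadratic representation `2 L_c² - L_c` of a primitive idempotent `c` is the orthogonal
projection onto the line spanned by `c`. -/
lemma IsAssocForm.primitive_quadratic (hB : IsAssocForm B) {c : V} (hc : IsPrimitiveIdempotent c)
    (hc0 : c ≠ 0) (x : V) : c * (c * x) + c * (c * x) - c * x = (B x c / B c c) • c := by
  have hcc := hc.1
  have hV1 : c * (c * (c * x) + c * (c * x) - c * x) = c * (c * x) + c * (c * x) - c * x := by
    have h := idempotent_cubic hcc x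
    simp only [mul_add, mul_sub]
    rw [← sub_eq_zero] at h ⊢
    rw [← h]
    abel
  obtain ⟨α, hα⟩ := hB.eq_smul_of_primitive_mul_eq hc hV1
  have hval : B x c = α * B c c := by
    have h := congrArg (fun y => B y c) hα
    simpa [hB.mul_left, hcc] using h
  rw [hα, hval, mul_div_assoc, div_self (hB.pos c hc0).ne', mul_one]

/-- Primitive idempotents that are not orthogonal have the same norm: the number
`2 ‖c ∘ d‖² - ⟨c, d⟩`, which is symmetric in `c` and `d`, equals `⟨c, d⟩² / ⟨c, c⟩`. -/
lemma IsAssocForm.primitive_norm_eq (hB : IsAssocForm B) {c d : V} (hc : IsPrimitiveIdempotent c)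
    (hc0 : c ≠ 0) (hd : IsPrimitiveIdempotent d) (hd0 : d ≠ 0) (hcd : B c d ≠ 0) :
    B c c = B d d := by
  have h1 := congrArg (fun y => B y d) (hB.primitive_quadratic hc hc0 d)
  have h2 := congrArg (fun y => B y c) (hB.primitive_quadratic hd hd0 c)
  simp only [map_add, map_sub, map_smul, LinearMap.add_apply, LinearMap.sub_apply,
    LinearMap.smul_apply, smul_eq_mul] at h1 h2
  have e1 : B (c * (c * d)) d = B (d * (d * c)) c := by
    rw [hB.mul_left c, hB.mul_left d, mul_comm d c]
  have e2 : B (c * d) d = B c d := by rw [hB.assoc, hd.1]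
  have e3 : B (d * c) c = B c d := by rw [hB.assoc, hc.1, hB.symm]
  rw [e1, e2] at h1
  rw [e3, h1, hB.symm d c] at h2
  have hcp := (hB.pos c hc0).ne'
  have hdp := (hB.pos d hd0).ne'
  field_simp at h2
  exact h2.symm

/-- The element `∑ cᵢ / ⟨cᵢ, cᵢ⟩` that represents the trace of a Jordan frame in the form `B`. -/
def frameWeight (B : V →ₗ[ℝ] V →ₗ[ℝ] ℝ) {k : ℕ} (c : Fin k → V) : V := ∑ i, (B (c i) (c i))⁻¹ • c i

lemma IsAssocForm.frameWeight_primitive (hB : IsAssocForm B) {k : ℕ} {c : Fin k → V}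
    (hc : IsJordanFrame c) {d : V} (hd : IsPrimitiveIdempotent d) (hd0 : d ≠ 0) :
    B (frameWeight B c) d = 1 := by
  have hterm : ∀ i, (B (c i) (c i))⁻¹ * B (c i) d = (B d d)⁻¹ * B (c i) d := by
    intro i
    by_cases h : B (c i) d = 0
    · rw [h, mul_zero, mul_zero]
    · rw [hB.primitive_norm_eq (hc.primitive i) (hc.ne_zero i) hd hd0 h]
  have hsum : ∑ i, B (c i) d = B d d := by
    rw [← LinearMap.sum_apply, ← map_sum, hc.2.2, ← hd.1, ← hB.eq_one_mul, hd.1]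
  simp only [frameWeight, map_sum, LinearMap.sum_apply, map_smul, LinearMap.smul_apply,
    smul_eq_mul, hterm]
  rw [← Finset.mul_sum, hsum, inv_mul_cancel₀ (hB.pos d hd0).ne']

/-- The element that represents the trace does not depend on the Jordan frame. -/
lemma IsAssocForm.frameWeight_eq (hB : IsAssocForm B) {k l : ℕ} {c : Fin k → V} {d : Fin l → V}
    (hc : IsJordanFrame c) (hd : IsJordanFrame d) : frameWeight B c = frameWeight B d := by
  have h : ∀ x, B (frameWeight B c) x = B (frameWeight B d) x := by
    intro x
    obtain ⟨m, f, lam, hf, rfl⟩ := hB.exists_jordanFrame x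
    simp only [map_sum, map_smul]
    refine Finset.sum_congr rfl fun i _ => ?_
    rw [hB.frameWeight_primitive hc (hf.primitive i) (hf.ne_zero i),
      hB.frameWeight_primitive hd (hf.primitive i) (hf.ne_zero i)]
  rw [← sub_eq_zero]
  refine hB.eq_zero (le_of_eq ?_)
  rw [LinearMap.map_sub₂, h, sub_self]

/-- The element that represents the trace is central, because it is a combination of any frame and
multiplications by orthogonal idempotents commute. -/
lemma IsAssocForm.frameWeight_mul_mul (hB : IsAssocForm B) {k : ℕ} {c : Fin k → V}
    (hc : IsJordanFrame c) (x y : V) :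
    frameWeight B c * (x * y) = x * (frameWeight B c * y) := by
  obtain ⟨m, d, lam, hd, rfl⟩ := hB.exists_jordanFrame x
  rw [hB.frameWeight_eq hc hd]
  simp only [frameWeight, Finset.sum_mul, Finset.mul_sum, smul_mul_assoc, mul_smul_comm,
    Finset.smul_sum]
  rw [Finset.sum_comm]
  refine Finset.sum_congr rfl fun i _ => Finset.sum_congr rfl fun j _ => ?_
  rw [smul_comm]
  congr 2
  rcases eq_or_ne i j with rfl | hij
  · rfl
  · exact mul_comm_mul_of_orthogonal (hd.idem _) (hd.2.1 _ _ hij) y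

variable (V) in
/-- There is an associative positive definite form in which the unit represents a linear form that
equals `1` on all primitive idempotents. -/
lemma exists_normalized_form (hB : IsAssocForm B) : ∃ G : V →ₗ[ℝ] V →ₗ[ℝ] ℝ, IsAssocForm G ∧
    ∀ c : V, IsPrimitiveIdempotent c → c ≠ 0 → G 1 c = 1 := by
  obtain ⟨k, c, -, hc, -⟩ := hB.exists_jordanFrame (1 : V)
  have hG1 : ∀ x y, B (frameWeight B c * x) y = B (frameWeight B c) (x * y) :=
    fun x y => hB.assoc _ _ _
  refine ⟨B ∘ₗ LinearMap.mulLeft ℝ (frameWeight B c), ⟨?_, ?_⟩, ?_⟩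
  · intro x y z
    simp only [LinearMap.comp_apply, LinearMap.mulLeft_apply]
    rw [mul_comm x y, hB.frameWeight_mul_mul hc, hB.mul_left]
  · intro x hx
    simp only [LinearMap.comp_apply, LinearMap.mulLeft_apply]
    rw [hG1]
    obtain ⟨m, d, lam, hd, rfl⟩ := hB.exists_jordanFrame x
    rw [hd.sum_smul_mul_sum_smul, map_sum]
    have hterm : ∀ i, B (frameWeight B c) ((lam i * lam i) • d i) = lam i * lam i := by
      intro i
      rw [map_smul, hB.frameWeight_primitive hc (hd.primitive i) (hd.ne_zero i), smul_eq_mul,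
        mul_one]
    simp only [hterm]
    have hex : ∃ i, lam i ≠ 0 := by
      by_contra h
      push Not at h
      exact hx (by simp [h])
    obtain ⟨i, hi⟩ := hex
    exact Finset.sum_pos' (fun i _ => mul_self_nonneg _)
      ⟨i, Finset.mem_univ i, mul_self_pos.mpr hi⟩
  · intro d hd hd0
    simp only [LinearMap.comp_apply, LinearMap.mulLeft_apply]
    rw [mul_one, hB.frameWeight_primitive hc hd hd0]

/-- All Jordan frames have `jordanRank V` elements: their size is the trace of the unit, and the
powers of an element are polynomials in its eigenvalues along a frame. -/
lemma IsAssocForm.jordanFrame_card (hB : IsAssocForm B) {k : ℕ} {c : Fin k → V}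
    (hc : IsJordanFrame c) : k = jordanRank V := by
  have hcard : ∀ {l : ℕ} {d : Fin l → V}, IsJordanFrame d → l = k := by
    intro l d hd
    obtain ⟨G, -, hG1⟩ := exists_normalized_form V hB
    have h : ∀ {m : ℕ} {f : Fin m → V}, IsJordanFrame f → G 1 1 = m := by
      intro m f hf
      have h1 : G 1 (∑ i, f i) = m := by
        rw [map_sum]
        simp [hG1 _ (hf.primitive _) (hf.ne_zero _)]
      rwa [hf.2.2] at h1
    exact_mod_cast (h hd).symm.trans (h hc)
  have hmem : ∀ x : V, ¬ LinearIndependent ℝ (fun i : Fin (k + 1) => jpow x (i : ℕ)) := by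
    intro x hli
    obtain ⟨l, d, lam, hd, rfl⟩ := hB.exists_jordanFrame x
    obtain rfl := hcard hd
    have hle : Submodule.span ℝ (Set.range fun i : Fin (l + 1) =>
        jpow (∑ i, lam i • d i) (i : ℕ)) ≤ Submodule.span ℝ (Set.range d) := by
      rw [Submodule.span_le]
      rintro _ ⟨n, rfl⟩
      simp only [hd.jpow_sum_smul]
      exact Submodule.sum_mem _ fun i _ =>
        Submodule.smul_mem _ _ (Submodule.subset_span (Set.mem_range_self i))
    have h1 := finrank_span_eq_card hli
    have h2 := Submodule.finrank_mono hle
    have h3 : Module.finrank ℝ (Submodule.span ℝ (Set.range d)) ≤ l := by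
      simpa [Set.finrank] using finrank_range_le_card (R := ℝ) d
    simp only [Fintype.card_fin] at h1
    omega
  refine le_antisymm (le_csInf ⟨k, hmem⟩ ?_) (Nat.sInf_le hmem)
  intro r hr
  by_contra hlt
  push Not at hlt
  -- an element with `k` distinct eigenvalues has `k` independent powers (Vandermonde)
  apply hr (∑ i : Fin k, ((i : ℕ) : ℝ) • c i)
  have hli : LinearIndependent ℝ
      (fun n : Fin k => jpow (∑ i : Fin k, ((i : ℕ) : ℝ) • c i) (n : ℕ)) := by
    rw [Fintype.linearIndependent_iff]
    intro g hg
    simp only [hc.jpow_sum_smul, Finset.smul_sum, smul_smul] at hg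
    rw [Finset.sum_comm] at hg
    simp only [← Finset.sum_smul] at hg
    have h0 := hc.eq_zero_of_sum_smul hg
    have hinj : Function.Injective fun i : Fin k => ((i : ℕ) : ℝ) := fun i j hij =>
      Fin.ext (Nat.cast_injective (R := ℝ) hij)
    have hg0 := Matrix.eq_zero_of_forall_index_sum_pow_mul_eq_zero hinj (v := g) fun j => by
      rw [← h0 j]
      exact Finset.sum_congr rfl fun n _ => mul_comm _ _
    exact fun i => congrFun hg0 i
  exact hli.comp (Fin.castLE (by omega : r + 1 ≤ k)) (Fin.castLE_injective _)

end Trace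

/-! ### Eigenvalues and the trace -/

section Eigenvalues

variable {V : Type*} [NonAssocCommRing V] [Module ℝ V]

/-- An associative positive definite form with `⟨e, c⟩ = 1` for all primitive idempotents `c`. -/
structure IsTraceForm (G : V →ₗ[ℝ] V →ₗ[ℝ] ℝ) : Prop extends IsAssocForm G where
  primitive : ∀ c : V, IsPrimitiveIdempotent c → c ≠ 0 → G 1 c = 1

variable {G : V →ₗ[ℝ] V →ₗ[ℝ] ℝ}

lemma IsTraceForm.one_sum_smul (hG : IsTraceForm G) {k : ℕ} {c : Fin k → V}
    (hc : IsJordanFrame c) (a : Fin k → ℝ) : G 1 (∑ i, a i • c i) = ∑ i, a i := by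
  rw [map_sum]
  simp [hG.primitive _ (hc.primitive _) (hc.ne_zero _)]

lemma IsTraceForm.idem_self (hG : IsTraceForm G) {k : ℕ} {c : Fin k → V}
    (hc : IsJordanFrame c) (i : Fin k) : G (c i) (c i) = 1 := by
  rw [hG.eq_one_mul, hc.idem, hG.primitive _ (hc.primitive i) (hc.ne_zero i)]

variable [SMulCommClass ℝ V V]

lemma IsTraceForm.frame_sum_smul (hG : IsTraceForm G) {k : ℕ} {c : Fin k → V}
    (hc : IsJordanFrame c) (a : Fin k → ℝ) (i : Fin k) : G (c i) (∑ j, a j • c j) = a i := by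
  rw [hG.eq_one_mul, hc.sum_smul_mul, map_smul,
    hG.primitive _ (hc.primitive i) (hc.ne_zero i), smul_eq_mul, mul_one]

variable [IsScalarTower ℝ V V]

lemma IsTraceForm.sum_smul_self (hG : IsTraceForm G) {k : ℕ} {c : Fin k → V}
    (hc : IsJordanFrame c) (a : Fin k → ℝ) :
    G (∑ i, a i • c i) (∑ i, a i • c i) = ∑ i, a i * a i := by
  rw [hG.eq_one_mul, hc.sum_smul_mul_sum_smul, hG.one_sum_smul hc]

variable [FiniteDimensional ℝ V]

variable (V) in
lemma exists_isTraceForm [IsEuclideanJordanAlgebra V] :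
    ∃ G : V →ₗ[ℝ] V →ₗ[ℝ] ℝ, IsTraceForm G := by
  have := IsEuclideanJordanAlgebra.jordan (V := V)
  obtain ⟨B, h1, h2⟩ := IsEuclideanJordanAlgebra.exists_form (V := V)
  obtain ⟨G, hG, hG1⟩ := exists_normalized_form V (B := B) ⟨h1, h2⟩
  exact ⟨G, hG, hG1⟩

lemma exists_isSpectralDecomposition [IsEuclideanJordanAlgebra V] (x : V) :
    ∃ c, IsSpectralDecomposition x (eigenvalues x) c := by
  have := IsEuclideanJordanAlgebra.jordan (V := V)
  have hex : ∃ lam : Fin (jordanRank V) → ℝ, ∃ c, IsSpectralDecomposition x lam c := by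
    obtain ⟨G, hG⟩ := exists_isTraceForm V
    obtain ⟨k, c, lam, hc, hx⟩ := hG.exists_jordanFrame x
    obtain rfl := hG.jordanFrame_card hc
    exact ⟨lam, c, hc, hx⟩
  rw [eigenvalues, dif_pos hex]
  exact hex.choose_spec

lemma IsTraceForm.trace_eq [IsEuclideanJordanAlgebra V] (hG : IsTraceForm G) (x : V) :
    trace x = G 1 x := by
  obtain ⟨c, hc, hx⟩ := exists_isSpectralDecomposition x
  conv_rhs => rw [hx]
  rw [hG.one_sum_smul hc, trace]

lemma IsTraceForm.ip_eq [IsEuclideanJordanAlgebra V] (hG : IsTraceForm G) (x y : V) :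
    ip x y = G x y := by
  rw [ip, hG.trace_eq, ← hG.eq_one_mul]

lemma IsTraceForm.frobNorm_sq [IsEuclideanJordanAlgebra V] (hG : IsTraceForm G) (x : V) :
    frobNorm x ^ 2 = G x x := by
  rw [frobNorm, hG.ip_eq, Real.sq_sqrt (hG.nonneg x)]

end Eigenvalues

/-! ### The cone of squares -/

section Cone

variable {V : Type*} [NonAssocCommRing V] [Module ℝ V] [IsScalarTower ℝ V V] [SMulCommClass ℝ V V]

lemma sum_smul_mem_squares {k : ℕ} {c : Fin k → V} (hc : IsJordanFrame c) {a : Fin k → ℝ}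
    (ha : ∀ i, 0 ≤ a i) : ∑ i, a i • c i ∈ Set.range fun x : V => x * x := by
  refine ⟨∑ i, √(a i) • c i, ?_⟩
  simp only [hc.sum_smul_mul_sum_smul, Real.mul_self_sqrt (ha _)]

variable [IsEuclideanJordanAlgebra V] [FiniteDimensional ℝ V] {G : V →ₗ[ℝ] V →ₗ[ℝ] ℝ}

/-- The cone of squares is dual to the set of idempotents. -/
lemma IsTraceForm.mem_squares_iff (hG : IsTraceForm G) {x : V} :
    (x ∈ Set.range fun x : V => x * x) ↔ ∀ c : V, c * c = c → 0 ≤ G c x := by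
  have := IsEuclideanJordanAlgebra.jordan (V := V)
  constructor
  · rintro ⟨y, rfl⟩ c hc
    exact hG.idempotent_mul_self_nonneg hc y
  · intro h
    obtain ⟨c, hc, hx⟩ := exists_isSpectralDecomposition x
    rw [hx]
    refine sum_smul_mem_squares hc fun i => ?_
    rw [← hG.frame_sum_smul hc (eigenvalues x) i, ← hx]
    exact h _ (hc.idem i)

lemma IsTraceForm.convex_squares (hG : IsTraceForm G) :
    Convex ℝ (Set.range fun x : V => x * x) := by
  intro x hx y hy a b ha hb _
  rw [hG.mem_squares_iff] at *
  intro c hc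
  have h1 := mul_nonneg ha (hx c hc)
  have h2 := mul_nonneg hb (hy c hc)
  simp only [map_add, map_smul, smul_eq_mul]
  linarith

lemma IsTraceForm.squares_nonneg (hG : IsTraceForm G) {x y : V}
    (hx : x ∈ Set.range fun x : V => x * x) (hy : y ∈ Set.range fun x : V => x * x) :
    0 ≤ G x y := by
  obtain ⟨c, hc, hxc⟩ := exists_isSpectralDecomposition x
  rw [hG.mem_squares_iff] at hx hy
  have hlam : ∀ i, 0 ≤ eigenvalues x i := fun i => by
    rw [← hG.frame_sum_smul hc (eigenvalues x) i, ← hxc]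
    exact hx _ (hc.idem i)
  rw [hxc]
  simp only [map_sum, map_smul, LinearMap.sum_apply, LinearMap.smul_apply, smul_eq_mul]
  exact Finset.sum_nonneg fun i _ => mul_nonneg (hlam i) (hy _ (hc.idem i))

/-- A square of trace `1` has norm at most `1`. -/
lemma IsTraceForm.self_le_one (hG : IsTraceForm G) {x : V}
    (hx : x ∈ Set.range fun x : V => x * x) (h1 : G 1 x = 1) : G x x ≤ 1 := by
  obtain ⟨c, hc, hxc⟩ := exists_isSpectralDecomposition x
  rw [hG.mem_squares_iff] at hx
  have hlam : ∀ i, 0 ≤ eigenvalues x i := fun i => by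
    rw [← hG.frame_sum_smul hc (eigenvalues x) i, ← hxc]
    exact hx _ (hc.idem i)
  have hsum : ∑ i, eigenvalues x i = 1 := by rw [← hG.one_sum_smul hc, ← hxc, h1]
  have hle : ∀ i, eigenvalues x i ≤ 1 := fun i => by
    rw [← hsum]
    exact Finset.single_le_sum (fun j _ => hlam j) (Finset.mem_univ i)
  rw [hxc, hG.sum_smul_self hc, ← hsum]
  exact Finset.sum_le_sum fun i _ => mul_le_of_le_one_left (hlam i) (hle i)

lemma IsTraceForm.sub_self_le_two (hG : IsTraceForm G) {x y : V}
    (hx : x ∈ Set.range fun x : V => x * x) (hx1 : G 1 x = 1)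
    (hy : y ∈ Set.range fun x : V => x * x) (hy1 : G 1 y = 1) : G (x - y) (x - y) ≤ 2 := by
  have h1 := hG.self_le_one hx hx1
  have h2 := hG.self_le_one hy hy1
  have h3 := hG.squares_nonneg hx hy
  have h4 := hG.squares_nonneg hy hx
  simp only [map_sub, LinearMap.sub_apply]
  linarith

variable [TopologicalSpace V] [IsTopologicalAddGroup V] [ContinuousSMul ℝ V] [T2Space V]

lemma IsTraceForm.isClosed_squares (hG : IsTraceForm G) :
    IsClosed (Set.range fun x : V => x * x) := by
  have h : (Set.range fun x : V => x * x) = ⋂ (c : V) (_ : c * c = c), {x | 0 ≤ G c x} := by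
    ext x
    rw [hG.mem_squares_iff]
    simp
  rw [h]
  exact isClosed_iInter fun c => isClosed_iInter fun _ =>
    isClosed_le continuous_const (G c).continuous_of_finiteDimensional

/-- Elements with positive eigenvalues are interior points of the cone of squares: the eigenvalues
of `y` are the numbers `⟨y, d⟩` for the idempotents `d` of a frame, and each of them is at least the
least eigenvalue of `x` minus `‖y - x‖`. -/
lemma IsTraceForm.sum_smul_mem_openCone (hG : IsTraceForm G) {k : ℕ} {c : Fin k → V}
    (hc : IsJordanFrame c) {a : Fin k → ℝ} (ha : ∀ i, 0 < a i) :
    ∑ i, a i • c i ∈ openCone V := by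
  have := IsEuclideanJordanAlgebra.jordan (V := V)
  obtain ⟨δ, hδ, hδa⟩ : ∃ δ : ℝ, 0 < δ ∧ ∀ i, δ ≤ a i := by
    rcases isEmpty_or_nonempty (Fin k) with h | h
    · exact ⟨1, one_pos, fun i => h.elim i⟩
    · obtain ⟨i, hi⟩ := Finite.exists_min a
      exact ⟨a i, ha i, hi⟩
  obtain ⟨n, e, he⟩ := exists_equiv_euclidean hG.toIsAssocForm
  have hecont : Continuous e := e.toLinearMap.continuous_of_finiteDimensional
  set x := ∑ i, a i • c i with hx
  rw [openCone, mem_interior]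
  refine ⟨{y | ‖e (y - x)‖ < δ}, ?_, ?_, ?_⟩
  · intro y hy
    obtain ⟨d, hd, hyd⟩ := exists_isSpectralDecomposition y
    rw [hyd]
    refine sum_smul_mem_squares hd fun i => ?_
    rw [← hG.frame_sum_smul hd (eigenvalues y) i, ← hyd]
    have hnorm : ‖e (d i)‖ = 1 := by
      have h := hG.idem_self hd i
      rw [he, real_inner_self_eq_norm_sq] at h
      exact (pow_eq_one_iff_of_nonneg (norm_nonneg _) two_ne_zero).mp h
    have h1 : |G (d i) (y - x)| < δ := by
      rw [he]
      refine (abs_real_inner_le_norm _ _).trans_lt ?_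
      rw [hnorm, one_mul]
      exact hy
    have h2 : δ ≤ G (d i) x := by
      have hone : G (d i) (∑ j, c j) = 1 := by
        rw [hc.2.2, hG.symm, hG.primitive _ (hd.primitive i) (hd.ne_zero i)]
      rw [map_sum] at hone
      rw [hx, map_sum, ← mul_one δ, ← hone, Finset.mul_sum]
      refine Finset.sum_le_sum fun j _ => ?_
      rw [map_smul, smul_eq_mul]
      exact mul_le_mul_of_nonneg_right (hδa j) (hG.idempotent_nonneg (hd.idem i) (hc.idem j))
    have h3 := (abs_lt.mp h1).1
    rw [map_sub] at h3
    linarith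
  · exact isOpen_lt (hecont.comp (continuous_id.sub continuous_const)).norm continuous_const
  · simpa using hδ

lemma IsTraceForm.closure_openCone (hG : IsTraceForm G) :
    closure (openCone V) = Set.range fun x : V => x * x := by
  apply subset_antisymm
  · exact closure_minimal interior_subset hG.isClosed_squares
  · intro x hx
    obtain ⟨c, hc, hxc⟩ := exists_isSpectralDecomposition x
    rw [hG.mem_squares_iff] at hx
    have hlam : ∀ i, 0 ≤ eigenvalues x i := fun i => by
      rw [← hG.frame_sum_smul hc (eigenvalues x) i, ← hxc]
      exact hx _ (hc.idem i)
    -- `x` is the limit of `x + ε e`, whose eigenvalues are positive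
    have ht : Tendsto (fun ε : ℝ => x + ε • (1 : V)) (𝓝[>] 0) (𝓝 x) := by
      have h : Continuous fun ε : ℝ => x + ε • (1 : V) := by fun_prop
      have h0 := h.tendsto 0
      simp only [zero_smul, add_zero] at h0
      exact h0.mono_left nhdsWithin_le_nhds
    refine mem_closure_of_tendsto ht ?_
    filter_upwards [self_mem_nhdsWithin] with ε hε
    have h : x + ε • (1 : V) = ∑ i, (eigenvalues x i + ε) • c i := by
      simp only [add_smul, Finset.sum_add_distrib, ← Finset.smul_sum, hc.2.2, ← hxc]
    rw [h]
    exact hG.sum_smul_mem_openCone hc fun i => add_pos_of_nonneg_of_pos (hlam i) hε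

lemma IsTraceForm.mem_spectraplex_iff (hG : IsTraceForm G) {x : V} :
    x ∈ spectraplex V ↔ (x ∈ Set.range fun x : V => x * x) ∧ G 1 x = 1 := by
  rw [← hG.closure_openCone, ← hG.ip_eq]
  rfl

lemma IsTraceForm.frame_mem_spectraplex (hG : IsTraceForm G) {k : ℕ} {c : Fin k → V}
    (hc : IsJordanFrame c) (i : Fin k) : c i ∈ spectraplex V :=
  hG.mem_spectraplex_iff.mpr ⟨⟨c i, hc.idem i⟩, hG.primitive _ (hc.primitive i) (hc.ne_zero i)⟩

lemma IsTraceForm.convex_spectraplex (hG : IsTraceForm G) : Convex ℝ (spectraplex V) := by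
  intro x hx y hy a b ha hb hab
  rw [hG.mem_spectraplex_iff] at *
  refine ⟨hG.convex_squares hx.1 hy.1 ha hb hab, ?_⟩
  rw [map_add, map_smul, map_smul, hx.2, hy.2, smul_eq_mul, smul_eq_mul, mul_one, mul_one, hab]

lemma IsTraceForm.isCompact_spectraplex (hG : IsTraceForm G) : IsCompact (spectraplex V) := by
  obtain ⟨n, e, he⟩ := exists_equiv_euclidean hG.toIsAssocForm
  have hcont : Continuous e.symm := e.symm.toLinearMap.continuous_of_finiteDimensional
  have hclosed : IsClosed (spectraplex V) := by
    have h : spectraplex V = (Set.range fun x : V => x * x) ∩ {x | G 1 x = 1} :=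
      Set.ext fun x => hG.mem_spectraplex_iff
    rw [h]
    exact hG.isClosed_squares.inter
      (isClosed_eq (G 1).continuous_of_finiteDimensional continuous_const)
  refine ((isCompact_closedBall (0 : EuclideanSpace ℝ (Fin n)) 1).image hcont).of_isClosed_subset
    hclosed fun x hx => ⟨e x, ?_, e.symm_apply_apply x⟩
  rw [hG.mem_spectraplex_iff] at hx
  have h := hG.self_le_one hx.1 hx.2
  rw [he, real_inner_self_eq_norm_sq] at h
  rw [mem_closedBall_zero_iff]
  exact (sq_le_one_iff₀ (norm_nonneg _)).mp h

/-- A point outside the open cone is separated from it by a primitive idempotent, namely by one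
that belongs to a non-positive eigenvalue. -/
lemma IsTraceForm.exists_le_zero_of_notMem_openCone (hG : IsTraceForm G) {x : V}
    (hx : x ∉ openCone V) : ∃ w ∈ spectraplex V, G x w ≤ 0 := by
  obtain ⟨c, hc, hxc⟩ := exists_isSpectralDecomposition x
  have hex : ∃ i, eigenvalues x i ≤ 0 := by
    by_contra h
    push Not at h
    refine hx ?_
    rw [hxc]
    exact hG.sum_smul_mem_openCone hc h
  obtain ⟨i, hi⟩ := hex
  refine ⟨c i, hG.frame_mem_spectraplex hc i, ?_⟩
  rw [hG.symm, hxc, hG.frame_sum_smul hc]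
  exact hi

/-! ### The smoothed minimization -/

lemma IsTraceForm.smoothMin_spec (hG : IsTraceForm G) {ubar : V} (hu : ubar ∈ spectraplex V)
    (μ : ℝ) (v : V) : smoothMin ubar μ v ∈ spectraplex V ∧
      IsMinOn (fun w => G w v + μ / 2 * G (w - ubar) (w - ubar)) (spectraplex V)
        (smoothMin ubar μ v) := by
  have hex : ∃ u, u ∈ spectraplex V ∧
      IsMinOn (fun w => ip w v + μ / 2 * frobNorm (w - ubar) ^ 2) (spectraplex V) u := by
    simp only [hG.frobNorm_sq, hG.ip_eq]
    refine hG.isCompact_spectraplex.exists_isMinOn ⟨ubar, hu⟩ (Continuous.continuousOn ?_)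
    obtain ⟨n, e, he⟩ := exists_equiv_euclidean hG.toIsAssocForm
    have hecont : Continuous e := e.toLinearMap.continuous_of_finiteDimensional
    simp only [he]
    fun_prop
  have h := Classical.epsilon_spec hex
  simp only [hG.frobNorm_sq, hG.ip_eq] at h
  unfold smoothMin
  simp only [hG.frobNorm_sq, hG.ip_eq]
  exact h

/-- The first-order optimality condition for the smoothed minimization. -/
lemma IsTraceForm.smoothMin_variational (hG : IsTraceForm G) {ubar : V}
    (hu : ubar ∈ spectraplex V) {μ : ℝ} (hμ : 0 ≤ μ) (v : V) {w : V} (hw : w ∈ spectraplex V) :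
    0 ≤ G (w - smoothMin ubar μ v) v +
      μ * G (w - smoothMin ubar μ v) (smoothMin ubar μ v - ubar) := by
  obtain ⟨hs, hmin⟩ := hG.smoothMin_spec hu μ v
  set s := smoothMin ubar μ v
  set D := G (w - s) v + μ * G (w - s) (s - ubar) with hD
  set E := μ / 2 * G (w - s) (w - s) with hE
  have hE0 : 0 ≤ E := mul_nonneg (by linarith) (hG.nonneg _)
  have hline : ∀ t : ℝ, 0 ≤ t → t ≤ 1 → 0 ≤ t * D + t ^ 2 * E := by
    intro t ht0 ht1
    have hmem : s + t • (w - s) ∈ spectraplex V := by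
      have h := hG.convex_spectraplex hs hw (by linarith : (0 : ℝ) ≤ 1 - t) ht0 (by ring)
      convert h using 1
      module
    have h := hmin hmem
    rw [Set.mem_ofPred_eq] at h
    have hsub : s + t • (w - s) - ubar = (s - ubar) + t • (w - s) := by abel
    have hsy : G (s - ubar) (w - s) = G (w - s) (s - ubar) := hG.symm _ _
    simp only [hsub, map_add, LinearMap.add_apply, map_smul, LinearMap.smul_apply, smul_eq_mul,
      hsy] at h
    rw [hD, hE]
    linarith
  -- for `D < 0` the point at `t = -D / (E - D)` would improve on the minimizer
  by_contra hneg
  push Not at hneg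
  have hpos : 0 < E - D := by linarith
  have h := hline (-D / (E - D)) (div_nonneg (by linarith) hpos.le)
    ((div_le_one hpos).mpr (by linarith))
  have hval : -D / (E - D) * D + (-D / (E - D)) ^ 2 * E = D ^ 3 / (E - D) ^ 2 := by
    field_simp
    ring
  rw [hval] at h
  have h3 : D ^ 3 < 0 := Odd.pow_neg ⟨1, by norm_num⟩ hneg
  exact absurd h (not_le.mpr (div_neg_of_neg_of_pos h3 (by positivity)))

end Cone

/-! ### The excessive gap -/

section Gap

variable {V : Type*} [AddCommGroup V] [Module ℝ V]

/-- The excessive gap of the points `u` and `z` at smoothing parameter `mu`: the smoothed concave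
function
`-½ ‖P u‖² + min_s {⟨P u, s⟩ + (mu / 2) ‖s - ū‖²}`, with `s` in the place of the minimizer, minus
the convex function `½ ‖P z‖²`. -/
def excessGap (G : V →ₗ[ℝ] V →ₗ[ℝ] ℝ) (P : V →ₗ[ℝ] V) (ubar : V) (mu : ℝ) (u s z : V) : ℝ :=
  -(1 / 2) * G (P u) (P u) + G s (P u) + mu / 2 * G (s - ubar) (s - ubar) -
    1 / 2 * G (P z) (P z)

variable {G : V →ₗ[ℝ] V →ₗ[ℝ] ℝ} {P : V →ₗ[ℝ] V}

lemma excessGap_init_nonneg (hsymm : ∀ x y, G x y = G y x)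
    (hP : ∀ x y, G x (P y) = G (P x) (P y)) (hle : ∀ x, G (P x) (P x) ≤ G x x)
    (hnn : ∀ x, 0 ≤ G x x) (ubar s : V) : 0 ≤ excessGap G P ubar 2 ubar s s := by
  have h1 := hle (s - ubar)
  have h2 := hnn (s - ubar)
  have e : G (P (s - ubar)) (P (s - ubar)) =
      G (P s) (P s) - 2 * G (P s) (P ubar) + G (P ubar) (P ubar) := by
    simp only [map_sub, LinearMap.sub_apply, hsymm (P ubar) (P s)]
    ring
  rw [e] at h1
  rw [excessGap, hP s]
  linarith

/-- One step of the scheme multiplies the excessive gap at least by `1 - θ`, and increases it by a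
multiple of `‖P (u - z)‖²`. The points `s` and `w` stand for the old and the new minimizer, and `hs`
is the optimality condition of `s`. -/
lemma excessGap_step (hsymm : ∀ x y, G x y = G y x)
    (hP : ∀ x y, G x (P y) = G (P x) (P y)) (hle : ∀ x, G (P x) (P x) ≤ G x x)
    (hnn : ∀ x, 0 ≤ G x x) {ubar u s z w : V} {θ mu : ℝ} (hθ0 : 0 ≤ θ) (hθ1 : θ ≤ 1)
    (hmu : θ ^ 2 ≤ (1 - θ) * mu) (hs : 0 ≤ G (w - s) (P u) + mu * G (w - s) (s - ubar)) :
    (1 - θ) * excessGap G P ubar mu u s z + (1 - θ) ^ 2 * θ / 2 * G (P (u - z)) (P (u - z)) ≤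
      excessGap G P ubar ((1 - θ) * mu) ((1 - θ) • (u + θ • z) + θ ^ 2 • s) w
        ((1 - θ) • z + θ • w) := by
  have h1θ : 0 ≤ 1 - θ := by linarith
  have k1 := mul_nonneg h1θ hs
  have k2 := mul_le_mul_of_nonneg_right hmu (hnn (w - s))
  have k3 := mul_le_mul_of_nonneg_left (hle (w - s)) (sq_nonneg θ)
  have k4 := mul_nonneg (mul_nonneg h1θ (sq_nonneg θ)) (hnn (P (u - s)))
  have k5 := mul_nonneg (mul_nonneg (mul_nonneg hθ0 h1θ) (sq_nonneg θ)) (hnn (P (z - s)))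
  have e1 : G (w - s) (P u) = G (P w) (P u) - G (P s) (P u) := by
    rw [hP, map_sub, map_sub, LinearMap.sub_apply]
  have e2 : G (w - ubar) (w - ubar) = G (w - s) (w - s) + 2 * G (w - s) (s - ubar) +
      G (s - ubar) (s - ubar) := by
    have h : w - ubar = (w - s) + (s - ubar) := by abel
    rw [h]
    simp only [map_add, LinearMap.add_apply, hsymm (s - ubar) (w - s)]
    ring
  rw [e1] at k1
  simp only [excessGap]
  rw [e2, hP s, hP w]
  generalize G (w - s) (w - s) = a1 at *
  generalize G (w - s) (s - ubar) = a2 at *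
  generalize G (s - ubar) (s - ubar) = a3 at *
  simp only [map_add, map_sub, map_smul, LinearMap.add_apply, LinearMap.sub_apply,
    LinearMap.smul_apply, smul_eq_mul, hsymm (P z) (P u), hsymm (P s) (P u), hsymm (P w) (P u),
    hsymm (P s) (P z), hsymm (P w) (P z), hsymm (P w) (P s)] at *
  -- `u' - w` is the convex combination of `u - w`, `z - w`, `s - w` with weights `1 - θ`,
  -- `θ (1 - θ)`, `θ²`; the nonnegative terms are its variance and the strong convexity term
  linear_combination k1 + k2 / 2 + k3 / 2 + k4 / 2 + k5 / 2

end Gap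

/-- The numerical inequality behind the last step of the complexity estimate. With
`p = ‖P u‖²`, `q = ‖P z‖²` and `d = ‖P (u - z)‖²` at the next to last iterate and `q'` the value of
`‖P z‖²` at the last one, `q` and `q'` cannot both exceed `8 / (m + 1)²`. -/
lemma last_step_contradiction {m p q d q' : ℝ} (hm : 67 ≤ m) (hq : 8 / (m + 1) ^ 2 < q)
    (hpq : p + q ≤ 8 / ((m - 1) * m)) (hd : 4 / 5 * q - 4 * p ≤ d)
    (hq' : 8 / (m + 1) ^ 2 < q')
    (hlast : q' + (1 - 2 / (m + 1)) ^ 2 * (2 / (m + 1)) * d ≤ 8 / (m * (m + 1))) : False := by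
  have hm1 : 0 < m - 1 := by linarith
  have hm0 : 0 < m := by linarith
  have hmp : 0 < m + 1 := by linarith
  -- the bound `8 / ((m - 1) m)` exceeds `8 / (m + 1)²` by a factor of at most `1 + 23 / 500`
  have hratio : 8 / ((m - 1) * m) ≤ 523 / 500 * (8 / (m + 1) ^ 2) := by
    rw [← mul_div_assoc, div_le_div_iff₀ (by positivity) (by positivity)]
    nlinarith
  have hd2 : 77 / 125 * (8 / (m + 1) ^ 2) ≤ d := by linarith
  have hcoef : 0 ≤ (1 - 2 / (m + 1)) ^ 2 * (2 / (m + 1)) := by positivity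
  have h1 := mul_le_mul_of_nonneg_left hd2 hcoef
  have h2 : 8 / (m + 1) ^ 2 + (1 - 2 / (m + 1)) ^ 2 * (2 / (m + 1)) *
      (77 / 125 * (8 / (m + 1) ^ 2)) < 8 / (m * (m + 1)) := by linarith
  have e1 : 8 / (m + 1) ^ 2 + (1 - 2 / (m + 1)) ^ 2 * (2 / (m + 1)) *
      (77 / 125 * (8 / (m + 1) ^ 2)) =
      8 * ((m + 1) ^ 3 + 154 / 125 * (m - 1) ^ 2) / (m + 1) ^ 5 := by
    field_simp
    ring
  rw [e1, div_lt_div_iff₀ (by positivity) (by positivity)] at h2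
  have h3 : 154 / 125 * (m - 1) ^ 2 * m < (m + 1) ^ 3 := by
    have h5 : (m + 1) * ((154 / 125 * (m - 1) ^ 2 * m)) < (m + 1) * (m + 1) ^ 3 := by
      nlinarith
    exact lt_of_mul_lt_mul_left h5 hmp.le
  nlinarith [mul_nonneg hm0.le (by linarith : 0 ≤ m - 67), mul_nonneg (mul_nonneg hm0.le hm0.le)
    (by linarith : 0 ≤ m - 67)]

/-! ### Convergence of the scheme -/

section Scheme

variable {V : Type*} [NonAssocCommRing V] [Module ℝ V]

lemma iterate_mu (P : V →ₗ[ℝ] V) (ubar : V) [TopologicalSpace V] (t : ℕ) :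
    (iterate P ubar t).mu = 4 / (((t : ℝ) + 1) * ((t : ℝ) + 2)) := by
  induction t with
  | zero => norm_num [iterate, initState]
  | succ t ih =>
    have h : (iterate P ubar (t + 1)).mu = (1 - 2 / ((t : ℝ) + 3)) * (iterate P ubar t).mu := rfl
    rw [h, ih]
    push_cast
    field_simp
    ring

variable [IsScalarTower ℝ V V] [SMulCommClass ℝ V V] [IsEuclideanJordanAlgebra V]
  [FiniteDimensional ℝ V] {G : V →ₗ[ℝ] V →ₗ[ℝ] ℝ} {L : Submodule ℝ V} {P : V →ₗ[ℝ] V}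

lemma IsTraceForm.apply_proj (hG : IsTraceForm G) (hP : IsOrthProj L P) (x y : V) :
    G x (P y) = G (P x) (P y) := by
  have h := hP.2 x (P y) (hP.1 y)
  rwa [hG.ip_eq, LinearMap.map_sub₂, sub_eq_zero] at h

lemma IsTraceForm.proj_le (hG : IsTraceForm G) (hP : IsOrthProj L P) (x : V) :
    G (P x) (P x) ≤ G x x := by
  have h1 := hG.nonneg (x - P x)
  have h2 := hG.apply_proj hP x x
  have h3 := hG.symm (P x) x
  simp only [map_sub, LinearMap.sub_apply] at h1
  linarith

variable [TopologicalSpace V] [IsTopologicalAddGroup V] [ContinuousSMul ℝ V] [T2Space V] {ubar : V}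

lemma IsTraceForm.iterate_z_mem (hG : IsTraceForm G) (hu : ubar ∈ spectraplex V) (t : ℕ) :
    (iterate P ubar t).z ∈ spectraplex V := by
  induction t with
  | zero => exact (hG.smoothMin_spec hu 2 (P ubar)).1
  | succ t ih =>
    have hz : (iterate P ubar (t + 1)).z = (1 - 2 / ((t : ℝ) + 3)) • (iterate P ubar t).z +
        (2 / ((t : ℝ) + 3)) • smoothMin ubar (iterate P ubar (t + 1)).mu
          (P (iterate P ubar (t + 1)).u) := rfl
    have hθ : 2 / ((t : ℝ) + 3) ≤ 1 := (div_le_one (by positivity)).mpr (by linarith)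
    rw [hz]
    exact hG.convex_spectraplex ih (hG.smoothMin_spec hu _ _).1 (by linarith) (by positivity)
      (by ring)

/-- The excessive gap of the `t`-th iterate. -/
def iterateGap (G : V →ₗ[ℝ] V →ₗ[ℝ] ℝ) (P : V →ₗ[ℝ] V) (ubar : V) (t : ℕ) : ℝ :=
  excessGap G P ubar (iterate P ubar t).mu (iterate P ubar t).u
    (smoothMin ubar (iterate P ubar t).mu (P (iterate P ubar t).u)) (iterate P ubar t).z

lemma IsTraceForm.iterateGap_succ (hG : IsTraceForm G) (hP : IsOrthProj L P)
    (hu : ubar ∈ spectraplex V) (t : ℕ) :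
    (1 - 2 / ((t : ℝ) + 3)) * iterateGap G P ubar t +
      (1 - 2 / ((t : ℝ) + 3)) ^ 2 * (2 / ((t : ℝ) + 3)) / 2 *
        G (P ((iterate P ubar t).u - (iterate P ubar t).z))
          (P ((iterate P ubar t).u - (iterate P ubar t).z)) ≤ iterateGap G P ubar (t + 1) := by
  have hθ : 2 / ((t : ℝ) + 3) ≤ 1 := (div_le_one (by positivity)).mpr (by linarith)
  have hmu := iterate_mu P ubar t
  have hmu0 : 0 ≤ (iterate P ubar t).mu := by rw [hmu]; positivity
  have hθmu : (2 / ((t : ℝ) + 3)) ^ 2 ≤ (1 - 2 / ((t : ℝ) + 3)) * (iterate P ubar t).mu := by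
    have h1 : (1 - 2 / ((t : ℝ) + 3)) * (4 / (((t : ℝ) + 1) * ((t : ℝ) + 2))) =
        4 / (((t : ℝ) + 3) * ((t : ℝ) + 2)) := by
      field_simp
      ring
    rw [hmu, h1, div_pow, div_le_div_iff₀ (by positivity) (by positivity)]
    nlinarith [(Nat.cast_nonneg t : (0 : ℝ) ≤ t)]
  exact excessGap_step hG.symm (hG.apply_proj hP) (hG.proj_le hP) hG.nonneg (by positivity) hθ
    hθmu (hG.smoothMin_variational hu hmu0 _
      (hG.smoothMin_spec hu (iterate P ubar (t + 1)).mu (P (iterate P ubar (t + 1)).u)).1)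

lemma IsTraceForm.iterateGap_nonneg (hG : IsTraceForm G) (hP : IsOrthProj L P)
    (hu : ubar ∈ spectraplex V) (t : ℕ) : 0 ≤ iterateGap G P ubar t := by
  induction t with
  | zero =>
    exact excessGap_init_nonneg hG.symm (hG.apply_proj hP) (hG.proj_le hP) hG.nonneg _ _
  | succ t ih =>
    have hθ : 2 / ((t : ℝ) + 3) ≤ 1 := (div_le_one (by positivity)).mpr (by linarith)
    refine le_trans ?_ (hG.iterateGap_succ hP hu t)
    exact add_nonneg (mul_nonneg (by linarith) ih) (mul_nonneg (by positivity) (hG.nonneg _))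

/-- If some `w` in the spectraplex has `⟨P u_t, w⟩ ≤ 0`, then the minimum in the excessive gap is at
most `μ_t`, because the spectraplex has diameter at most `√2`. -/
lemma IsTraceForm.iterateGap_le (hG : IsTraceForm G) (hu : ubar ∈ spectraplex V) (t : ℕ)
    (hw : ∃ w ∈ spectraplex V, G (P (iterate P ubar t).u) w ≤ 0) :
    2 * iterateGap G P ubar t + G (P (iterate P ubar t).u) (P (iterate P ubar t).u) +
      G (P (iterate P ubar t).z) (P (iterate P ubar t).z) ≤ 8 / (((t : ℝ) + 1) * (t + 2)) := by
  obtain ⟨w, hw, hneg⟩ := hw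
  have hmu := iterate_mu P ubar t
  have hmu0 : 0 ≤ (iterate P ubar t).mu := by rw [hmu]; positivity
  have h1 := isMinOn_iff.mp
    (hG.smoothMin_spec hu (iterate P ubar t).mu (P (iterate P ubar t).u)).2 w hw
  rw [hG.symm w (P (iterate P ubar t).u)] at h1
  rw [hG.mem_spectraplex_iff] at hw hu
  have h2 := mul_le_mul_of_nonneg_left (hG.sub_self_le_two hw.1 hw.2 hu.1 hu.2) hmu0
  have h3 : 8 / (((t : ℝ) + 1) * (t + 2)) = 2 * (iterate P ubar t).mu := by rw [hmu]; ring
  rw [h3, iterateGap, excessGap]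
  linarith

/-- Complexity estimate: after at most `⌊A⌋ - 1` iterations the scheme has stopped, provided that
`⌊A⌋` is large or the rounding is harmless. When `A² ≤ ⌊A⌋ (⌊A⌋ + 1)`, the bound
`‖P z_t‖² ≤ 8 / ((t + 1) (t + 2))` suffices. In general it misses by a relative error of order
`1 / A`, which is made up for by the term `‖P (u_t - z_t)‖²` in the last step of the excessive
gap. -/
lemma IsTraceForm.exists_iterate_le (hG : IsTraceForm G) (hP : IsOrthProj L P)
    (hu : ubar ∈ spectraplex V) {A : ℝ} {m : ℕ} (hm : 1 ≤ m) (hmA : (m : ℝ) ≤ A)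
    (hAm : A < m + 1) (hlarge : A ^ 2 ≤ m * (m + 1) ∨ 67 ≤ m) {halted : ℕ → Prop}
    (hsep : ∀ t, ¬ halted t → ∃ w ∈ spectraplex V, G (P (iterate P ubar t).u) w ≤ 0) :
    ∃ t : ℕ, (t : ℝ) ≤ A - 1 ∧
      (halted t ∨ G (P (iterate P ubar t).z) (P (iterate P ubar t).z) ≤ 8 / A ^ 2) := by
  by_contra hcon
  push Not at hcon
  have hm1 : (1 : ℝ) ≤ m := by exact_mod_cast hm
  have hA0 : 0 < A := by linarith
  obtain ⟨hns, hz⟩ := hcon (m - 1) (by rw [Nat.cast_sub hm]; push_cast; linarith)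
  have hgap := hG.iterateGap_le hu (m - 1) (hsep _ hns)
  have hpu := hG.nonneg (P (iterate P ubar (m - 1)).u)
  have hcast : ((m - 1 : ℕ) : ℝ) = m - 1 := by rw [Nat.cast_sub hm]; norm_num
  have e1 : ((m : ℝ) - 1 + 1) * (m - 1 + 2) = m * (m + 1) := by ring
  rw [hcast, e1] at hgap
  rcases hlarge with h | h67
  · have hnn := hG.iterateGap_nonneg hP hu (m - 1)
    have h1 : 8 / ((m : ℝ) * (m + 1)) ≤ 8 / A ^ 2 :=
      div_le_div_of_nonneg_left (by norm_num) (by positivity) h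
    linarith
  · obtain ⟨k, rfl⟩ : ∃ k, m = k + 2 := ⟨m - 2, by omega⟩
    have e2 : k + 2 - 1 = k + 1 := by omega
    rw [e2] at hz hgap hpu
    have hk : (67 : ℝ) ≤ (k : ℝ) + 2 := by exact_mod_cast h67
    push_cast at hgap hmA hAm hcast
    obtain ⟨hns', hz'⟩ := hcon k (by linarith)
    have hgap' := hG.iterateGap_le hu k (hsep _ hns')
    have hnn := hG.iterateGap_nonneg hP hu k
    have hstep := hG.iterateGap_succ hP hu k
    have hθ : 2 / ((k : ℝ) + 3) ≤ 1 := (div_le_one (by positivity)).mpr (by linarith)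
    have hprod := mul_nonneg (sub_nonneg.mpr hθ) hnn
    have hA2 : 8 / ((k : ℝ) + 2 + 1) ^ 2 < 8 / A ^ 2 := by
      refine div_lt_div_of_pos_left (by norm_num) (by positivity) ?_
      exact pow_lt_pow_left₀ hAm hA0.le two_ne_zero
    -- `‖b - a‖² ≥ (1 - ε) ‖b‖² - (1 / ε - 1) ‖a‖²` with `ε = 1 / 5`
    have hd : 4 / 5 * G (P (iterate P ubar k).z) (P (iterate P ubar k).z) -
        4 * G (P (iterate P ubar k).u) (P (iterate P ubar k).u) ≤
        G (P ((iterate P ubar k).u - (iterate P ubar k).z))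
          (P ((iterate P ubar k).u - (iterate P ubar k).z)) := by
      have h := hG.nonneg ((5 : ℝ) • P (iterate P ubar k).u - P (iterate P ubar k).z)
      simp only [map_sub, map_smul, LinearMap.sub_apply, LinearMap.smul_apply, smul_eq_mul,
        hG.symm (P (iterate P ubar k).z) (P (iterate P ubar k).u)] at h ⊢
      linarith
    have e3 : (k : ℝ) + 2 + 1 = k + 3 := by ring
    have e4 : ((k : ℝ) + 2 - 1) * (k + 2) = (k + 1) * (k + 2) := by ring
    refine last_step_contradiction (m := (k : ℝ) + 2) hk (hA2.trans hz') ?_ hd (hA2.trans hz) ?_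
    · rw [e4]
      linarith
    · rw [e3] at hgap ⊢
      linarith

end Scheme

/-! ### The bounds -/

section Bounds

/-- The rounding hypothesis of the complexity estimate for the bound `8 √2 r²`. -/
lemma exists_floor_rank {r : ℕ} (hr : 1 ≤ r) : ∃ m : ℕ, 1 ≤ m ∧ (m : ℝ) ≤ 8 * √2 * (r : ℝ) ^ 2 ∧
    8 * √2 * (r : ℝ) ^ 2 < m + 1 ∧
    ((8 * √2 * (r : ℝ) ^ 2) ^ 2 ≤ m * (m + 1) ∨ 67 ≤ m) := by
  set A : ℝ := 8 * √2 * (r : ℝ) ^ 2 with hA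
  have hA2 : A ^ 2 = 128 * (r : ℝ) ^ 4 := by
    rw [hA, mul_pow, mul_pow, Real.sq_sqrt (by norm_num)]
    ring
  have hA0 : 0 ≤ A := by positivity
  have hle : ∀ j : ℕ, j ^ 2 ≤ 128 * r ^ 4 → j ≤ ⌊A⌋₊ := fun j hj => by
    refine Nat.le_floor (le_of_sq_le_sq ?_ hA0)
    rw [hA2]
    exact_mod_cast hj
  refine ⟨⌊A⌋₊, ?_, Nat.floor_le hA0, Nat.lt_floor_add_one A, ?_⟩
  · exact hle 1 (by nlinarith [Nat.one_le_pow 4 r hr])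
  · have h3 : r = 1 ∨ r = 2 ∨ 3 ≤ r := by omega
    rcases h3 with h | h | h
    · left
      have h1 : (11 : ℝ) ≤ ⌊A⌋₊ := by exact_mod_cast hle 11 (by rw [h]; norm_num)
      rw [hA2, h]
      norm_num
      nlinarith
    · left
      have h1 : (45 : ℝ) ≤ ⌊A⌋₊ := by exact_mod_cast hle 45 (by rw [h]; norm_num)
      rw [hA2, h]
      norm_num
      nlinarith
    · right
      exact hle 67 (by nlinarith [Nat.pow_le_pow_left h 4])

/-- The rounding hypothesis of the complexity estimate for the bound `6 n √(2 n)`. -/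
lemma exists_floor_dim {n : ℕ} (hn : 1 ≤ n) : ∃ m : ℕ, 1 ≤ m ∧
    (m : ℝ) ≤ 6 * (n : ℝ) * √(2 * (n : ℝ)) ∧ 6 * (n : ℝ) * √(2 * (n : ℝ)) < m + 1 ∧
    ((6 * (n : ℝ) * √(2 * (n : ℝ))) ^ 2 ≤ m * (m + 1) ∨ 67 ≤ m) := by
  set A : ℝ := 6 * (n : ℝ) * √(2 * (n : ℝ)) with hA
  have hA2 : A ^ 2 = 72 * (n : ℝ) ^ 3 := by
    rw [hA, mul_pow, Real.sq_sqrt (by positivity)]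
    ring
  have hA0 : 0 ≤ A := by positivity
  have hle : ∀ j : ℕ, j ^ 2 ≤ 72 * n ^ 3 → j ≤ ⌊A⌋₊ := fun j hj => by
    refine Nat.le_floor (le_of_sq_le_sq ?_ hA0)
    rw [hA2]
    exact_mod_cast hj
  refine ⟨⌊A⌋₊, ?_, Nat.floor_le hA0, Nat.lt_floor_add_one A, ?_⟩
  · exact hle 1 (by nlinarith [Nat.one_le_pow 3 n hn])
  · have h3 : n = 1 ∨ n = 2 ∨ n = 3 ∨ 4 ≤ n := by omega
    rcases h3 with h | h | h | h
    · left
      have h1 : (8 : ℝ) ≤ ⌊A⌋₊ := by exact_mod_cast hle 8 (by rw [h]; norm_num)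
      rw [hA2, h]
      norm_num
      nlinarith
    · left
      have h1 : (24 : ℝ) ≤ ⌊A⌋₊ := by exact_mod_cast hle 24 (by rw [h]; norm_num)
      rw [hA2, h]
      norm_num
      nlinarith
    · left
      have h1 : (44 : ℝ) ≤ ⌊A⌋₊ := by exact_mod_cast hle 44 (by rw [h]; norm_num)
      rw [hA2, h]
      norm_num
      nlinarith
    · right
      exact hle 67 (by nlinarith [Nat.pow_le_pow_left h 3])

/-- A vector with coordinate sum `1` has a coordinate of absolute value at least `1 / r`. -/
lemma one_le_card_mul_norm {r : ℕ} {x : Fin r → ℝ} (hx : ∑ i, x i = 1) : 1 ≤ r * ‖x‖ := by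
  have h : ∑ i, x i ≤ ∑ _i : Fin r, ‖x‖ :=
    Finset.sum_le_sum fun i _ => (Real.le_norm_self _).trans (norm_le_pi_norm x i)
  rw [hx] at h
  simpa using h

end Bounds

/-! ### The algebra of vectors with the componentwise product -/

section Pi

variable {n : ℕ}

instance isEuclideanJordanAlgebra_pi : IsEuclideanJordanAlgebra (Fin n → ℝ) where
  jordan := ⟨fun a b => mul_assoc a b (a * a)⟩
  exists_form := by
    refine ⟨LinearMap.mk₂ ℝ (fun x y => x ⬝ᵥ y) add_dotProduct smul_dotProduct
      dotProduct_add dotProduct_smul, fun x y z => ?_, fun x hx => ?_⟩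
    · simp only [LinearMap.mk₂_apply, dotProduct, Pi.mul_apply, mul_assoc]
    · simp only [LinearMap.mk₂_apply]
      refine lt_of_le_of_ne (Finset.sum_nonneg fun i _ => mul_self_nonneg _) fun h => hx ?_
      exact dotProduct_self_eq_zero.mp h.symm

lemma isJordanFrame_pi_single : IsJordanFrame fun i : Fin n => (Pi.single i 1 : Fin n → ℝ) := by
  refine ⟨fun i => ⟨?_, ?_, ?_⟩, ?_, ?_⟩
  · simp
  · rw [← Pi.single_mul, mul_one]
  · rintro ⟨a, b, ha, hb, hac, hbc, hab⟩
    beta_reduce at hac hbc hab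
    have h01 : ∀ {v : Fin n → ℝ}, v * v = v → ∀ j, v j = 0 ∨ v j = 1 := by
      intro v hv j
      have h := congrFun hv j
      rw [Pi.mul_apply] at h
      have h2 : v j * (v j - 1) = 0 := by linarith
      exact (mul_eq_zero.mp h2).imp id sub_eq_zero.mp
    have hoff : ∀ j, j ≠ i → a j = 0 ∧ b j = 0 := by
      intro j hj
      have h := congrFun hab j
      rw [Pi.single_eq_of_ne hj, Pi.add_apply] at h
      rcases h01 ha j with h1 | h1 <;> rcases h01 hb j with h2 | h2 <;> rw [h1, h2] at h <;>
        norm_num at h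
      exact ⟨h1, h2⟩
    have hi := congrFun hab i
    rw [Pi.single_eq_same, Pi.add_apply] at hi
    rcases h01 ha i with h1 | h1
    · apply hbc
      ext j
      rcases eq_or_ne j i with rfl | hj
      · rw [Pi.single_eq_same]; linarith
      · rw [Pi.single_eq_of_ne hj, (hoff j hj).2]
    · apply hac
      ext j
      rcases eq_or_ne j i with rfl | hj
      · rw [Pi.single_eq_same, h1]
      · rw [Pi.single_eq_of_ne hj, (hoff j hj).1]
  · intro i j hij
    ext k
    rcases eq_or_ne k i with rfl | hk
    · simp [Pi.single_eq_of_ne hij]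
    · simp [Pi.single_eq_of_ne hk]
  · exact Finset.univ_sum_single (1 : Fin n → ℝ)

/-- The trace inner product of vectors is the dot product. -/
lemma IsTraceForm.pi_eq {G : (Fin n → ℝ) →ₗ[ℝ] (Fin n → ℝ) →ₗ[ℝ] ℝ} (hG : IsTraceForm G)
    (x y : Fin n → ℝ) : G x y = ∑ i, x i * y i := by
  have hxy : x * y = ∑ i, (x i * y i) • (Pi.single i 1 : Fin n → ℝ) := by
    rw [pi_eq_sum_univ' (x * y)]
    refine Finset.sum_congr rfl fun i _ => ?_
    ext j
    simp [Pi.single_apply]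
  rw [hG.eq_one_mul, hxy, hG.one_sum_smul isJordanFrame_pi_single]

end Pi

/-! ### The two complexity bounds -/

/-- The bound `8 √2 r² - 1` for a Euclidean Jordan algebra of rank `r`. It follows from the
complexity estimate with `A = 8 √2 r²`, as `‖z‖ ≥ 1 / r` on the spectraplex. -/
theorem exists_iterate_jordan (V : Type*) [NonAssocCommRing V] [Module ℝ V] [IsScalarTower ℝ V V]
    [SMulCommClass ℝ V V] [IsEuclideanJordanAlgebra V] [FiniteDimensional ℝ V]
    [TopologicalSpace V] [IsTopologicalAddGroup V] [ContinuousSMul ℝ V] [T2Space V]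
    (L : Submodule ℝ V) (P : V →ₗ[ℝ] V) (hP : IsOrthProj L P) (ubar : V)
    (hu : ubar ∈ spectraplex V) :
    ∃ t : ℕ, (t : ℝ) ≤ 8 * √2 * (jordanRank V : ℝ) ^ 2 - 1 ∧
      (P (iterate P ubar t).u ∈ openCone V ∨
        frobNorm (P (iterate P ubar t).z) ≤
          1 / (4 * (jordanRank V : ℝ)) * opNorm (iterate P ubar t).z) := by
  obtain ⟨G, hG⟩ := exists_isTraceForm V
  have hone : ∀ z ∈ spectraplex V, 1 ≤ (jordanRank V : ℝ) * opNorm z := fun z hz => by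
    refine one_le_card_mul_norm (x := eigenvalues z) ?_
    exact (hG.trace_eq z).trans (hG.mem_spectraplex_iff.mp hz).2
  have hr : 1 ≤ jordanRank V := by
    rw [Nat.one_le_iff_ne_zero]
    intro h0
    have h := hone ubar hu
    rw [h0, Nat.cast_zero, zero_mul] at h
    exact absurd h (by norm_num)
  have hr0 : (0 : ℝ) < jordanRank V := by exact_mod_cast hr
  obtain ⟨m, hm, hmA, hAm, hlarge⟩ := exists_floor_rank hr
  obtain ⟨t, htA, ht⟩ := hG.exists_iterate_le hP hu hm hmA hAm hlarge
    (halted := fun t => P (iterate P ubar t).u ∈ openCone V)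
    fun t ht => hG.exists_le_zero_of_notMem_openCone ht
  refine ⟨t, htA, ht.imp id fun hz => ?_⟩
  have hz1 := hone _ (hG.iterate_z_mem (P := P) hu t)
  have hop : 1 / (jordanRank V : ℝ) ≤ opNorm (iterate P ubar t).z :=
    (div_le_iff₀' hr0).mpr hz1
  have hbound : frobNorm (P (iterate P ubar t).z) ≤
      1 / (4 * (jordanRank V : ℝ)) * (1 / (jordanRank V : ℝ)) := by
    refine le_of_sq_le_sq ?_ (by positivity)
    rw [hG.frobNorm_sq]
    refine hz.trans (le_of_eq ?_)
    rw [mul_pow, mul_pow, Real.sq_sqrt (by norm_num)]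
    field_simp
    norm_num
  exact hbound.trans (mul_le_mul_of_nonneg_left hop (by positivity))

/-- The bound `6 n √(2 n) - 1` for vectors with the componentwise product. It follows from the
complexity estimate with `A = 6 n √(2 n)`, as `‖z‖ ≥ 1 / n` on the simplex. -/
theorem exists_iterate_pi (n : ℕ) (L : Submodule ℝ (Fin n → ℝ))
    (P : (Fin n → ℝ) →ₗ[ℝ] (Fin n → ℝ)) (hP : IsOrthProj L P) (ubar : Fin n → ℝ)
    (hu : ubar ∈ spectraplex (Fin n → ℝ)) :
    ∃ t : ℕ, (t : ℝ) ≤ 6 * (n : ℝ) * √(2 * (n : ℝ)) - 1 ∧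
      ((∀ i, 0 < P (iterate P ubar t).u i) ∨
        √(∑ i, max (P (iterate P ubar t).z i) 0 ^ 2) ≤
          1 / (3 * √(n : ℝ)) * ‖(iterate P ubar t).z‖) := by
  obtain ⟨G, hG⟩ := exists_isTraceForm (Fin n → ℝ)
  have hone : ∀ z ∈ spectraplex (Fin n → ℝ), 1 ≤ (n : ℝ) * ‖z‖ := fun z hz => by
    have h := (hG.mem_spectraplex_iff.mp hz).2
    rw [hG.pi_eq] at h
    exact one_le_card_mul_norm (by simpa using h)
  have hn : 1 ≤ n := by
    rw [Nat.one_le_iff_ne_zero]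
    rintro rfl
    exact absurd (hone ubar hu) (by norm_num)
  have hn0 : (0 : ℝ) < n := by exact_mod_cast hn
  obtain ⟨m, hm, hmA, hAm, hlarge⟩ := exists_floor_dim hn
  obtain ⟨t, htA, ht⟩ := hG.exists_iterate_le hP hu hm hmA hAm hlarge
    (halted := fun t => ∀ i, 0 < P (iterate P ubar t).u i) fun t ht => by
      push Not at ht
      obtain ⟨i, hi⟩ := ht
      refine ⟨Pi.single i 1, hG.frame_mem_spectraplex isJordanFrame_pi_single i, ?_⟩
      rw [hG.pi_eq]
      simpa [Pi.single_apply] using hi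
  refine ⟨t, htA, ht.imp id fun hz => ?_⟩
  have hz1 := hone _ (hG.iterate_z_mem (P := P) hu t)
  have hop : 1 / (n : ℝ) ≤ ‖(iterate P ubar t).z‖ := (div_le_iff₀' hn0).mpr hz1
  have hbound : √(∑ i, max (P (iterate P ubar t).z i) 0 ^ 2) ≤
      1 / (3 * √(n : ℝ)) * (1 / (n : ℝ)) := by
    refine Real.sqrt_le_iff.mpr ⟨by positivity, ?_⟩
    have hmax : ∑ i, max (P (iterate P ubar t).z i) 0 ^ 2 ≤
        G (P (iterate P ubar t).z) (P (iterate P ubar t).z) := by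
      rw [hG.pi_eq]
      refine Finset.sum_le_sum fun i _ => ?_
      rcases le_total (P (iterate P ubar t).z i) 0 with h | h
      · rw [max_eq_right h]
        nlinarith
      · rw [max_eq_left h, sq]
    refine hmax.trans (hz.trans (le_of_eq ?_))
    rw [mul_pow, mul_pow, Real.sq_sqrt (by positivity), mul_pow, div_pow, mul_pow,
      Real.sq_sqrt hn0.le]
    field_simp
    norm_num
  exact hbound.trans (mul_le_mul_of_nonneg_left hop (by positivity))

end SmoothPerceptron

end

theorem mainTheorem12 :
    (∀ (V : Type*) [NonAssocCommRing V] [Module ℝ V] [IsScalarTower ℝ V V]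
        [SMulCommClass ℝ V V] [IsEuclideanJordanAlgebra V] [FiniteDimensional ℝ V]
        [TopologicalSpace V] [IsTopologicalAddGroup V] [ContinuousSMul ℝ V] [T2Space V]
        (L : Submodule ℝ V) (P : V →ₗ[ℝ] V), SmoothPerceptron.IsOrthProj L P →
        ∀ ubar ∈ SmoothPerceptron.spectraplex V,
          ∃ t : ℕ, (t : ℝ) ≤ 8 * √2 * (SmoothPerceptron.jordanRank V : ℝ) ^ 2 - 1 ∧
            (P (SmoothPerceptron.iterate P ubar t).u ∈ SmoothPerceptron.openCone V ∨
              SmoothPerceptron.frobNorm (P (SmoothPerceptron.iterate P ubar t).z) ≤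
                1 / (4 * (SmoothPerceptron.jordanRank V : ℝ)) *
                  SmoothPerceptron.opNorm (SmoothPerceptron.iterate P ubar t).z)) ∧
    (∀ (n : ℕ) (L : Submodule ℝ (Fin n → ℝ)) (P : (Fin n → ℝ) →ₗ[ℝ] (Fin n → ℝ)),
        SmoothPerceptron.IsOrthProj L P →
        ∀ ubar ∈ SmoothPerceptron.spectraplex (Fin n → ℝ),
          ∃ t : ℕ, (t : ℝ) ≤ 6 * (n : ℝ) * √(2 * (n : ℝ)) - 1 ∧
            ((∀ i, 0 < P (SmoothPerceptron.iterate P ubar t).u i) ∨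
              √(∑ i, max (P (SmoothPerceptron.iterate P ubar t).z i) 0 ^ 2) ≤
                1 / (3 * √(n : ℝ)) * ‖(SmoothPerceptron.iterate P ubar t).z‖)) :=
  ⟨fun V => SmoothPerceptron.exists_iterate_jordan V, SmoothPerceptron.exists_iterate_pi⟩
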